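/- Let $D\subseteq\mathbb{R}^d$ be open and let $f$ be a smooth real vector field on $D$, with local flow $\varphi_h$ of $x'=f(x)$. Let $\mathcal S_h$ be a real one-step method on $D$ that is of order $2$ for $f$, i.e. $\mathcal S_h=\varphi_h+\mathcal O(h^3)$, and time-symmetric, i.e. $\mathcal S_{h}\circ\mathcal S_{-h}=\mathrm{id}$ for small $h$, and that extends holomorphically to complex step sizes near $0$ and complex states near $D$ (so that it can be used with complex coefficients). Here and below all $\mathcal O$-terms are for real $h\to0$ and locally uniform in $x\in D$, and all methods are considered for small $|h|$, locally on $D$. Let $\alpha_1,\dots,\alpha_s\in\mathbb{C}$ satisfy $\alpha_{s+1-j}=\overline{\alpha_j}$ for $j=1,\dots,s$, and consider the symmetric-conjugate composition and its real part $$\psi_h=\mathcal S_{\alpha_s h}\circ\cdots\circ\mathcal S_{\alpha_2 h}\circ\mathcal S_{\alpha_1 h},\qquad \hat R_h=\tfrac12\left(\psi_h+\overline{\psi_h}\right)$$ on real states and for real $h$. A method $M_h$ is of order $r$ if $M_h=\varphi_h+\mathcal O(h^{r+1})$. A real method $M_h$ is pseudo-symmetric of order $q$ if it is smooth in $(h,x)$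 and its adjoint $M_h^*=(M_{-h})^{-1}$ (local inverse) satisfies $M_h^*=M_h+\mathcal O(h^{q+1})$. For $d=2m$ and $J$ the canonical symplectic matrix, it is symplectic if $(M_h')^TJM_h'=J$ for small $h$, and pseudo-symplectic of order $p$ if it is smooth in $(h,x)$ and $(M_h')^TJM_h'=J+\mathcal O(h^{p+1})$, where $M_h'$ is the Jacobian matrix with respect to $x$. Let $n\ge 2$. (a) If $\psi_h$ is of odd order $2n-1$, then $\hat R_h$ is of order $2n$ and pseudo-symmetric of order $4n-1$. If in addition $d=2m$, $f=J\nabla H$ is a Hamiltonian vector field with a smooth real $H$ on $D$, and $\mathcal S_h$ is symplectic, then $\hat R_h$ is pseudo-symplectic of order $4n-1$. (b) If $\psi_h$ is of even order $2n$, then $\hat R_h$ is of order $2n$ and pseudo-symmetric of order $4n+3$. If in addition $d=2m$, $f=J\nabla H$ is a Hamiltonian vector field with a smooth real $H$ on $D$, and $\mathcal S_h$ is symplectic, then $\hat R_h$ is pseudo-symplectic of order $4n+3$. -/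

import Mathlib

open Filter Topology Asymptotics
open scoped ContDiff Matrix

/-- The real phase space `ℝ^d`. -/
abbrev RVec (d : ℕ) : Type := Fin d → ℝ

/-- The complexified phase space `ℂ^d`. -/
abbrev CVec (d : ℕ) : Type := Fin d → ℂ

/-- The inclusion of `ℝ^d` in `ℂ^d`. -/
def toComplex {d : ℕ} (x : RVec d) : CVec d := fun i => (x i : ℂ)

/-- `φ` is (near `x₀` and for small times) the flow of `x' = f x`: `t ↦ φ t x` is the solution
with initial value `x`, for all `(t, x)` near `(0, x₀)`. -/
def IsLocalFlowAt {d : ℕ} (f : RVec d → RVec d) (x₀ : RVec d) (φ : ℝ → RVec d → RVec d) : Prop :=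
  ContinuousAt (fun p : ℝ × RVec d => φ p.1 p.2) (0, x₀) ∧
    ∀ᶠ p : ℝ × RVec d in 𝓝 (0, x₀),
      φ 0 p.2 = p.2 ∧ HasDerivAt (fun t => φ t p.2) (f (φ p.1 p.2)) p.1

/-- The method `M` with values in `ℂ^d`, started at real points and used with real step sizes, has
order (at least) `r` for `x' = f x` on `D`: `M h x = φ h x + O(h^(r+1))`, locally uniformly in
`x ∈ D`, where `φ` is the flow of `f`. -/
def HasComplexOrder {d : ℕ} (f : RVec d → RVec d) (D : Set (RVec d))
    (M : ℝ → RVec d → CVec d) (r : ℕ) : Prop :=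
  ∀ x₀ ∈ D, ∃ φ : ℝ → RVec d → RVec d, IsLocalFlowAt f x₀ φ ∧
    (fun p : ℝ × RVec d => M p.1 p.2 - toComplex (φ p.1 p.2)) =O[𝓝 (0, x₀)]
      fun p => p.1 ^ (r + 1)

/-- The real method `M` has order (at least) `r` for `x' = f x` on `D`. -/
def HasOrder {d : ℕ} (f : RVec d → RVec d) (D : Set (RVec d))
    (M : ℝ → RVec d → RVec d) (r : ℕ) : Prop :=
  ∀ x₀ ∈ D, ∃ φ : ℝ → RVec d → RVec d, IsLocalFlowAt f x₀ φ ∧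
    (fun p : ℝ × RVec d => M p.1 p.2 - φ p.1 p.2) =O[𝓝 (0, x₀)] fun p => p.1 ^ (r + 1)

/-- `M (-h) ∘ M h = id` for all small `h`, locally on `D`. -/
def IsTimeSymmetric {d : ℕ} (D : Set (RVec d)) (M : ℝ → RVec d → RVec d) : Prop :=
  ∀ x₀ ∈ D, ∀ᶠ p : ℝ × RVec d in 𝓝 (0, x₀), M (-p.1) (M p.1 p.2) = p.2

/-- `M h x` is a smooth function of `(h, x)` for small `h`, locally in `x ∈ D`. -/
def IsSmoothMethod {d : ℕ} (D : Set (RVec d)) (M : ℝ → RVec d → RVec d) : Prop :=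
  ∀ x₀ ∈ D, ∃ U ∈ 𝓝 ((0 : ℝ), x₀), ContDiffOn ℝ ∞ (fun p : ℝ × RVec d => M p.1 p.2) U

/-- `N` is, near `x₀` and for small `h`, the adjoint method `N h = (M (-h))⁻¹` of `M`. The inverse
is the local one: `N h x` is close to `x₀` for `(h, x)` close to `(0, x₀)`. -/
def IsAdjointAt {d : ℕ} (x₀ : RVec d) (M N : ℝ → RVec d → RVec d) : Prop :=
  ContinuousAt (fun p : ℝ × RVec d => N p.1 p.2) (0, x₀) ∧ N 0 x₀ = x₀ ∧
    ∀ᶠ p : ℝ × RVec d in 𝓝 (0, x₀),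
      M (-p.1) (N p.1 p.2) = p.2 ∧ N p.1 (M (-p.1) p.2) = p.2

/-- The smooth method `M` is pseudo-symmetric of order `q`: its adjoint is `M h + O(h^(q+1))`,
locally uniformly on `D`. -/
def IsPseudoSymmetric {d : ℕ} (D : Set (RVec d)) (M : ℝ → RVec d → RVec d) (q : ℕ) : Prop :=
  IsSmoothMethod D M ∧
    ∀ x₀ ∈ D, ∃ N : ℝ → RVec d → RVec d, IsAdjointAt x₀ M N ∧
      (fun p : ℝ × RVec d => N p.1 p.2 - M p.1 p.2) =O[𝓝 (0, x₀)] fun p => p.1 ^ (q + 1)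

/-- The canonical symplectic matrix `[[0, I], [-I, 0]]`, where `e` names the coordinates of phase
space as positions `q₁, …, q_m` (left summand) and momenta `p₁, …, p_m` (right summand). -/
def canonicalJ {d m : ℕ} (e : Fin m ⊕ Fin m ≃ Fin d) : Matrix (Fin d) (Fin d) ℝ :=
  Matrix.reindex e e (Matrix.fromBlocks 0 1 (-1) 0)

/-- `f` is on `D` the Hamiltonian vector field `J ∇H` of a smooth real function `H`. -/
def IsHamiltonian {d m : ℕ} (e : Fin m ⊕ Fin m ≃ Fin d) (D : Set (RVec d))
    (f : RVec d → RVec d) : Prop :=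
  ∃ H : RVec d → ℝ, ContDiffOn ℝ ∞ H D ∧
    ∀ x ∈ D, f x = canonicalJ e *ᵥ fun j => fderiv ℝ H x (Pi.single j 1)

/-- The Jacobian matrix of `M h` at `x`. -/
noncomputable def jacobian {d : ℕ} (M : ℝ → RVec d → RVec d) (h : ℝ) (x : RVec d) :
    Matrix (Fin d) (Fin d) ℝ :=
  LinearMap.toMatrix' (fderiv ℝ (M h) x : RVec d →ₗ[ℝ] RVec d)

/-- `(M h)'ᵀ J (M h)' = J` for small `h`, locally on `D`. -/
def IsSymplecticMethod {d m : ℕ} (e : Fin m ⊕ Fin m ≃ Fin d) (D : Set (RVec d))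
    (M : ℝ → RVec d → RVec d) : Prop :=
  IsSmoothMethod D M ∧
    ∀ x₀ ∈ D, ∀ᶠ p : ℝ × RVec d in 𝓝 (0, x₀),
      (jacobian M p.1 p.2)ᵀ * canonicalJ e * jacobian M p.1 p.2 = canonicalJ e

/-- The smooth method `M` is pseudo-symplectic of order `q`: `(M h)'ᵀ J (M h)' = J + O(h^(q+1))`,
locally uniformly on `D`. -/
def IsPseudoSymplectic {d m : ℕ} (e : Fin m ⊕ Fin m ≃ Fin d) (D : Set (RVec d))
    (M : ℝ → RVec d → RVec d) (q : ℕ) : Prop :=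
  IsSmoothMethod D M ∧
    ∀ x₀ ∈ D, ∀ i j : Fin d,
      (fun p : ℝ × RVec d =>
        ((jacobian M p.1 p.2)ᵀ * canonicalJ e * jacobian M p.1 p.2 - canonicalJ e) i j)
          =O[𝓝 (0, x₀)] fun p => p.1 ^ (q + 1)

/-- `Sc` extends the real method `S` holomorphically to complex step sizes near `0` and complex
states near the points of `D`. -/
def IsHolomorphicExtension {d : ℕ} (D : Set (RVec d)) (S : ℝ → RVec d → RVec d)
    (Sc : ℂ → CVec d → CVec d) : Prop :=
  ∀ x₀ ∈ D, AnalyticAt ℂ (fun p : ℂ × CVec d => Sc p.1 p.2) (0, toComplex x₀) ∧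
    ∀ᶠ p : ℝ × RVec d in 𝓝 (0, x₀), Sc (p.1 : ℂ) (toComplex p.2) = toComplex (S p.1 p.2)

/-- The composition `ψ_h = S_{α_s h} ∘ ⋯ ∘ S_{α_2 h} ∘ S_{α_1 h}` (`S_{α_1 h}` acts first). -/
def composition {d s : ℕ} (Sc : ℂ → CVec d → CVec d) (α : Fin s → ℂ) (h : ℂ) (z : CVec d) :
    CVec d :=
  (List.ofFn α).foldl (fun y a => Sc (a * h) y) z

/-- The composition with real step size `h`, started at a real point. -/
def realStart {d s : ℕ} (Sc : ℂ → CVec d → CVec d) (α : Fin s → ℂ) (h : ℝ) (x : RVec d) :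
    CVec d :=
  composition Sc α (h : ℂ) (toComplex x)

/-- The real part `(ψ_h + conj ψ_h) / 2` of a composition, as a map of `ℝ^d`. -/
def realPartMethod {d s : ℕ} (Sc : ℂ → CVec d → CVec d) (α : Fin s → ℂ) (h : ℝ) (x : RVec d) :
    RVec d :=
  fun i => (realStart Sc α h x i).re

/-- The method `realPartMethod` is the arithmetic mean of the composition and its conjugate. -/
theorem toComplex_realPartMethod {d s : ℕ} (Sc : ℂ → CVec d → CVec d) (α : Fin s → ℂ) (h : ℝ)
    (x : RVec d) :
    toComplex (realPartMethod Sc α h x) =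
      (1 / 2 : ℂ) • (realStart Sc α h x + star (realStart Sc α h x)) := by
  funext i
  simp only [toComplex, realPartMethod, Pi.smul_apply, Pi.add_apply, Pi.star_apply, smul_eq_mul,
    Complex.star_def, Complex.re_eq_add_conj]
  ring

/-- `α_{s+1-j} = conj α_j` for `j = 1, …, s`. -/
def IsSymmetricConjugate {s : ℕ} (α : Fin s → ℂ) : Prop :=
  ∀ j : Fin s, α (Fin.rev j) = starRingEnd ℂ (α j)

/-! Write `ψ_h = u_h + i v_h` on real states, so that `u_h` is the real part method. Time symmetry
of the basic method makes the reversed composition with step `-h` the inverse of `ψ_h`. Since the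
reversed coefficients are the conjugate ones, this says `ψ_{-h}(u_h - i v_h) = x`
(`eventually_listComposition_neg_star`).

Suppose `v = O(h^k)`. Taylor expansion about the real point `u_h` gives `x = ψ_{-h}(u_h) - i
ψ'_{-h}(u_h) v_h + O(h^{2k})` (`conjugate_expansion`). Its real part is `u_{-h}(u_h) + v'_{-h}(u_h)
v_h = x + O(h^{2k})`. As `v'` is also `O(h^k)`, the map `u` is symmetric up to `O(h^{2k})`
(`realPartMap_symm_isBigO`), and the inverse function theorem transfers this defect to the adjoint
(`exists_adjoint`). Its imaginary part says `v_h - v_{-h}(u_h) = O(h^{k+1})`. For odd `k` the two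
leading terms add up, so the leading coefficient vanishes and `v = O(h^{k+1})`
(`imagPartMap_isBigO_succ`). If `ψ'_h = U + iV` preserves `J`, the real part of that identity is
`UᵀJU - VᵀJV = J`, with defect `VᵀJV = O(h^{2k})` (`realPartMap_symplectic_isBigO`).

The flow is real, so a composition of order `r` has `v = O(h^{r+1})`. In (a) this gives `k = 2n`.
The extra order of `u` comes from the parity argument for symmetric methods
(`isBigO_sub_flow_succ`). In (b) the odd exponent `2n+1` improves to `k = 2n+2`. Both pseudo-orders
are `2k - 1`.

Time symmetry, symplecticity and commutation with conjugation pass from real to complex arguments by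
the identity theorem (`eventually_eq_zero_of_real`). -/

set_option linter.unusedSectionVars false

/-! ### Calculus of smooth functions that are `O(h^k)` in the step size, locally uniformly in the
state. -/

section SmallStep

variable {X G : Type*} [NormedAddCommGroup X] [NormedSpace ℝ X]
  [NormedAddCommGroup G] [NormedSpace ℝ G]

/-- A property that holds near `(0, x₀)` holds on a product of two balls. -/
theorem exists_ball_of_eventually {P : ℝ × X → Prop} {x₀ : X}
    (h : ∀ᶠ p in 𝓝 ((0 : ℝ), x₀), P p) :
    ∃ ε > 0, ∀ (t : ℝ) (x : X), |t| < ε → ‖x - x₀‖ < ε → P (t, x) := by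
  obtain ⟨ε, hε, H⟩ := Metric.eventually_nhds_iff.1 h
  refine ⟨ε, hε, fun t x ht hx => H ?_⟩
  rw [Prod.dist_eq]
  exact max_lt (by simpa [Real.dist_eq] using ht) (by simpa [dist_eq_norm] using hx)

/-- Integration in the step size raises the order of smallness by one. -/
theorem isBigO_pow_succ_of_hasDerivAt {F F' : ℝ × X → G} {x₀ : X} {k : ℕ}
    (h0 : ∀ᶠ x in 𝓝 x₀, F (0, x) = 0)
    (hd : ∀ᶠ p in 𝓝 ((0 : ℝ), x₀), HasDerivAt (fun t => F (t, p.2)) (F' p) p.1)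
    (hb : F' =O[𝓝 (0, x₀)] fun p => p.1 ^ k) :
    F =O[𝓝 (0, x₀)] fun p => p.1 ^ (k + 1) := by
  obtain ⟨C, hC⟩ := hb.bound
  have h0' : ∀ᶠ p in 𝓝 ((0 : ℝ), x₀), F (0, p.2) = 0 :=
    (continuous_snd.tendsto ((0 : ℝ), x₀)).eventually h0
  obtain ⟨ε, hε, H⟩ := exists_ball_of_eventually (h0'.and (hd.and hC))
  refine IsBigO.of_bound C ?_
  filter_upwards [Metric.ball_mem_nhds ((0 : ℝ), x₀) hε] with p hp
  rw [Metric.mem_ball, Prod.dist_eq, max_lt_iff] at hp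
  have h1 : |p.1| < ε := by simpa [Real.dist_eq] using hp.1
  have h2 : ‖p.2 - x₀‖ < ε := by simpa [dist_eq_norm] using hp.2
  have habs : ∀ t ∈ Set.uIcc 0 p.1, |t| ≤ |p.1| := fun t ht => by
    simpa using Set.abs_sub_left_of_mem_uIcc ht
  have key := Convex.norm_image_sub_le_of_norm_hasDerivWithin_le
    (f := fun t => F (t, p.2)) (f' := fun t => F' (t, p.2)) (s := Set.uIcc 0 p.1)
    (x := 0) (y := p.1) (C := C * |p.1| ^ k)
    (fun t ht => ((H t p.2 ((habs t ht).trans_lt h1) h2).2.1).hasDerivWithinAt)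
    (fun t ht => by
      have h3 := (H t p.2 ((habs t ht).trans_lt h1) h2).2.2
      refine h3.trans ?_
      -- The constant of a big-O bound has no sign. A negative one forces `|h|^k = 0`, and then the
      -- bound is trivial on the whole segment.
      have hC0 : 0 ≤ C ∨ C < 0 := le_or_gt 0 C
      rcases hC0 with hC0 | hC0
      · rw [norm_pow, Real.norm_eq_abs]
        exact mul_le_mul_of_nonneg_left (pow_le_pow_left₀ (abs_nonneg _) (habs t ht) _) hC0
      · have h4 := (H p.1 p.2 h1 h2).2.2
        have h5 : |p.1| ^ k = 0 := by
          have h6 : 0 ≤ C * |p.1| ^ k := by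
            simpa [norm_pow] using (norm_nonneg _).trans h4
          by_contra hne
          have : 0 < |p.1| ^ k := lt_of_le_of_ne (by positivity) (Ne.symm hne)
          nlinarith
        have h7 : |t| ^ k = 0 :=
          le_antisymm (h5 ▸ pow_le_pow_left₀ (abs_nonneg _) (habs t ht) _) (by positivity)
        simp [norm_pow, h5, h7])
    (convex_uIcc _ _) Set.left_mem_uIcc Set.right_mem_uIcc
  have hz := (H p.1 p.2 h1 h2).1
  simp only [hz, sub_zero] at key
  simpa [norm_pow, pow_succ, mul_assoc] using key

/-- A leading coefficient of higher order vanishes. -/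
theorem eventually_eq_zero_of_pow_smul {w : X → G} {x₀ : X} {k : ℕ}
    (h : (fun p : ℝ × X => p.1 ^ k • w p.2) =O[𝓝 (0, x₀)] fun p => p.1 ^ (k + 1)) :
    ∀ᶠ x in 𝓝 x₀, w x = 0 := by
  obtain ⟨C, hC⟩ := h.bound
  obtain ⟨ε, hε, H⟩ := exists_ball_of_eventually hC
  filter_upwards [Metric.ball_mem_nhds x₀ hε] with x hx
  rw [← norm_le_zero_iff]
  have ht : Tendsto (fun t : ℝ => C * t) (𝓝[>] 0) (𝓝 0) := by
    have : Tendsto (fun t : ℝ => C * t) (𝓝 0) (𝓝 (C * 0)) :=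
      Continuous.tendsto (by fun_prop) 0
    simpa using this.mono_left nhdsWithin_le_nhds
  -- For fixed `x`, dividing by `t ^ k` leaves `‖w x‖ ≤ C * t` for all small `t > 0`.
  refine ge_of_tendsto ht ?_
  filter_upwards [Ioo_mem_nhdsGT hε] with t ht
  have h1 := H t x (by rw [abs_of_pos ht.1]; exact ht.2) (by simpa [dist_eq_norm] using hx)
  simp only [norm_smul, norm_pow, Real.norm_eq_abs, abs_of_pos ht.1] at h1
  have h2 : 0 < t ^ k := pow_pos ht.1 k
  rw [pow_succ] at h1
  nlinarith

/-- The derivative with respect to the step size. -/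
noncomputable def stepDeriv (F : ℝ × X → G) (p : ℝ × X) : G := fderiv ℝ F p (1, 0)

/-- The derivative with respect to the state. -/
noncomputable def stateDeriv (F : ℝ × X → G) (p : ℝ × X) : X →L[ℝ] G :=
  (fderiv ℝ F p).comp (ContinuousLinearMap.inr ℝ ℝ X)

theorem ContDiffAt.fderiv_infty {F : X → G} {p : X}
    (h : ContDiffAt ℝ ∞ F p) : ContDiffAt ℝ ∞ (fderiv ℝ F) p :=
  h.fderiv_right (by simp)

theorem ContDiffAt.stepDeriv {F : ℝ × X → G} {p : ℝ × X} (h : ContDiffAt ℝ ∞ F p) :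
    ContDiffAt ℝ ∞ (stepDeriv F) p :=
  h.fderiv_infty.clm_apply contDiffAt_const

theorem ContDiffAt.stateDeriv {F : ℝ × X → G} {p : ℝ × X} (h : ContDiffAt ℝ ∞ F p) :
    ContDiffAt ℝ ∞ (stateDeriv F) p :=
  h.fderiv_infty.clm_comp contDiffAt_const

theorem ContDiffAt.eventually_differentiableAt {F : X → G} {p : X}
    (h : ContDiffAt ℝ ∞ F p) : ∀ᶠ q in 𝓝 p, DifferentiableAt ℝ F q := by
  filter_upwards [(h.of_le (m := 1) (by simp)).eventually (by simp)] with q hq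
  exact hq.differentiableAt (by simp)

theorem hasDerivAt_stepDeriv {F : ℝ × X → G} {p : ℝ × X} (h : DifferentiableAt ℝ F p) :
    HasDerivAt (fun t => F (t, p.2)) (stepDeriv F p) p.1 :=
  HasFDerivAt.comp_hasDerivAt (x := p.1) (f := fun t : ℝ => (t, p.2)) (l := F)
    h.hasFDerivAt ((hasDerivAt_id p.1).prodMk (hasDerivAt_const p.1 p.2))

theorem hasFDerivAt_stateDeriv {F : ℝ × X → G} {p : ℝ × X} (h : DifferentiableAt ℝ F p) :
    HasFDerivAt (fun x => F (p.1, x)) (stateDeriv F p) p.2 :=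
  HasFDerivAt.comp (x := p.2) (f := fun x : X => (p.1, x)) (g := F)
    h.hasFDerivAt (hasFDerivAt_prodMk_right p.1 p.2)

theorem ContinuousAt.isBigO_one' {F : X → G} {p : X} (h : ContinuousAt F p) :
    F =O[𝓝 p] fun _ => (1 : ℝ) :=
  Tendsto.isBigO_one ℝ h

theorem isBigO_pow_mono {F : ℝ × X → G} {x₀ : X} {j k : ℕ} (hjk : j ≤ k)
    (h : F =O[𝓝 (0, x₀)] fun p => p.1 ^ k) : F =O[𝓝 (0, x₀)] fun p => p.1 ^ j := by
  refine h.trans ?_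
  have h1 : (fun p : ℝ × X => p.1 ^ (k - j)) =O[𝓝 (0, x₀)] fun _ => (1 : ℝ) :=
    ContinuousAt.isBigO_one' (by fun_prop)
  have h2 := (isBigO_refl (fun p : ℝ × X => p.1 ^ j) (𝓝 (0, x₀))).mul h1
  simpa [← pow_add, Nat.add_sub_cancel' hjk] using h2

theorem eventually_eq_zero_of_isBigO {F : ℝ × X → G} {x₀ : X} {k : ℕ}
    (h : F =O[𝓝 (0, x₀)] fun p => p.1 ^ (k + 1)) : ∀ᶠ x in 𝓝 x₀, F (0, x) = 0 := by
  have ht : Tendsto (fun x : X => ((0 : ℝ), x)) (𝓝 x₀) (𝓝 (0, x₀)) :=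
    (Continuous.prodMk_right (0 : ℝ)).tendsto x₀
  have h1 := h.comp_tendsto ht
  have h2 : (fun x => F (0, x)) =O[𝓝 x₀] fun _ => (0 : ℝ) := by
    simpa [Function.comp_def] using h1
  simpa [EventuallyEq] using isBigO_zero_right_iff.1 h2

/-- A smooth function that vanishes for step size `0` is of order one. -/
theorem isBigO_pow_one_of_contDiffAt {F : ℝ × X → G} {x₀ : X}
    (h : ContDiffAt ℝ ∞ F (0, x₀)) (h0 : ∀ᶠ x in 𝓝 x₀, F (0, x) = 0) :
    F =O[𝓝 (0, x₀)] fun p => p.1 ^ 1 := by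
  refine isBigO_pow_succ_of_hasDerivAt (k := 0) h0
    (h.eventually_differentiableAt.mono fun p hp => hasDerivAt_stepDeriv hp) ?_
  simpa using h.stepDeriv.continuousAt.isBigO_one'

theorem hasDerivAt_pow_smul (k : ℕ) (w : G) (t : ℝ) :
    HasDerivAt (fun t : ℝ => (t ^ (k + 1) / (k + 1)) • w) (t ^ k • w) t := by
  have h := ((hasDerivAt_pow (k + 1) t).div_const ((k : ℝ) + 1)).smul_const w
  convert h using 1
  have : (k : ℝ) + 1 ≠ 0 := by positivity
  congr 1
  push_cast
  field_simp

/-- A smooth function of order `k` has a smooth leading coefficient, and its derivative with respect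
to the step size is of order `k - 1`. -/
theorem exists_leading_coefficient {x₀ : X} (k : ℕ) :
    ∀ {E : ℝ × X → G}, ContDiffAt ℝ ∞ E (0, x₀) → E =O[𝓝 (0, x₀)] (fun p => p.1 ^ k) →
      (∃ w : X → G, ContDiffAt ℝ ∞ w x₀ ∧
        (fun p => E p - p.1 ^ k • w p.2) =O[𝓝 (0, x₀)] fun p => p.1 ^ (k + 1)) ∧
      stepDeriv E =O[𝓝 (0, x₀)] fun p => p.1 ^ (k - 1) := by
  have hι : ContDiffAt ℝ ∞ (fun x : X => ((0 : ℝ), x)) x₀ := by fun_prop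
  induction k using Nat.strong_induction_on with
  | _ k ih =>
  intro E hE hO
  have hpw : ∀ {j : ℕ} {w : X → G}, ContDiffAt ℝ ∞ w x₀ → E =O[𝓝 (0, x₀)] (fun p => p.1 ^ (j + 1)) →
      (fun p => stepDeriv E p - p.1 ^ j • w p.2) =O[𝓝 (0, x₀)] (fun p => p.1 ^ (j + 1)) →
      (fun p => E p - p.1 ^ (j + 1) • ((j : ℝ) + 1)⁻¹ • w p.2)
        =O[𝓝 (0, x₀)] fun p => p.1 ^ (j + 2) := by
    intro j w hw hEj hwO
    refine isBigO_pow_succ_of_hasDerivAt ?_ ?_ hwO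
    · filter_upwards [eventually_eq_zero_of_isBigO hEj] with x hx
      simp [hx]
    · filter_upwards [hE.eventually_differentiableAt] with p hp
      convert (hasDerivAt_stepDeriv hp).sub (hasDerivAt_pow_smul j (w p.2) p.1) using 1
      funext t
      simp [smul_smul, div_eq_mul_inv]
  have hO' : stepDeriv E =O[𝓝 (0, x₀)] fun p => p.1 ^ (k - 1) := by
    match k, ih, hO with
    | 0, _, _ | 1, _, _ => simpa using hE.stepDeriv.continuousAt.isBigO_one'
    | k + 2, ih, hO =>
      -- Forgetting one order gives `stepDeriv E = O(h^k)` with leading coefficient `w`. Integrated,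
      -- `E` has leading term `h^(k+1) w / (k+1)`, which the assumed order `k + 2` forces to vanish;
      -- hence `w = 0` and the derivative gains the missing order.
      have hO1 := isBigO_pow_mono (Nat.le_succ (k + 1)) hO
      have h1 := (ih (k + 1) (by omega) hE hO1).2
      obtain ⟨⟨w, hw, hwO⟩, -⟩ := ih k (by omega) hE.stepDeriv h1
      have h2 := hO.sub (hpw hw hO1 hwO)
      simp only [sub_sub_cancel] at h2
      have h3 := eventually_eq_zero_of_pow_smul (k := k + 1)
        (w := fun x => ((k : ℝ) + 1)⁻¹ • w x) h2
      have hk : ((k : ℝ) + 1)⁻¹ ≠ 0 := by positivity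
      refine hwO.congr' ?_ EventuallyEq.rfl
      filter_upwards [(continuous_snd.tendsto ((0 : ℝ), x₀)).eventually h3] with p hp
      simp [(smul_eq_zero_iff_right hk).1 hp]
  refine ⟨?_, hO'⟩
  match k, ih, hO, hO' with
  | 0, _, _, _ =>
    have hw : ContDiffAt ℝ ∞ (fun x => E (0, x)) x₀ := ContDiffAt.comp x₀ hE hι
    refine ⟨fun x => E (0, x), hw, ?_⟩
    simp only [pow_zero, one_smul, zero_add]
    refine isBigO_pow_one_of_contDiffAt (hE.sub ?_) (by simp)
    exact ContDiffAt.comp (g := fun x => E (0, x)) ((0 : ℝ), x₀) hw contDiffAt_snd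
  | k + 1, ih, hO, hO' =>
    obtain ⟨⟨w, hw, hwO⟩, -⟩ := ih k (by omega) hE.stepDeriv hO'
    exact ⟨fun x => ((k : ℝ) + 1)⁻¹ • w x, contDiffAt_const.smul hw, hpw hw hO hwO⟩

/-- Differentiation with respect to the state and to the step size commute. -/
theorem stepDeriv_stateDeriv {F : ℝ × X → G} {p : ℝ × X} (h : ContDiffAt ℝ 2 F p) :
    stepDeriv (stateDeriv F) p = stateDeriv (stepDeriv F) p := by
  have hd : DifferentiableAt ℝ (fderiv ℝ F) p := 
    (h.fderiv_right (m := 1) (by norm_num)).differentiableAt (by simp)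
  have hs : IsSymmSndFDerivAt ℝ F p := h.isSymmSndFDerivAt (by simp)
  ext v
  have h1 : HasFDerivAt (stepDeriv F)
      ((ContinuousLinearMap.apply ℝ G ((1 : ℝ), (0 : X))).comp (fderiv ℝ (fderiv ℝ F) p)) p :=
    (ContinuousLinearMap.apply ℝ G ((1 : ℝ), (0 : X))).hasFDerivAt.comp p hd.hasFDerivAt
  have h2 : HasFDerivAt (stateDeriv F)
      (((ContinuousLinearMap.compL ℝ X (ℝ × X) G).flip (ContinuousLinearMap.inr ℝ ℝ X)).comp
        (fderiv ℝ (fderiv ℝ F) p)) p :=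
    ((ContinuousLinearMap.compL ℝ X (ℝ × X) G).flip
      (ContinuousLinearMap.inr ℝ ℝ X)).hasFDerivAt.comp p hd.hasFDerivAt
  rw [stepDeriv, stateDeriv, h1.fderiv, h2.fderiv]
  exact hs (1, 0) (0, v)

theorem two_le_infty : (2 : WithTop ℕ∞) ≤ ∞ :=
  WithTop.coe_le_coe.2 le_top

theorem eventually_stepDeriv_stateDeriv {F : ℝ × X → G} {p : ℝ × X} (h : ContDiffAt ℝ ∞ F p) :
    ∀ᶠ q in 𝓝 p, stepDeriv (stateDeriv F) q = stateDeriv (stepDeriv F) q := by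
  filter_upwards [(h.of_le (m := 2) (two_le_infty)).eventually (by simp)] with q hq
  exact stepDeriv_stateDeriv hq

/-- Differentiation with respect to the state preserves the order of smallness. -/
theorem stateDeriv_isBigO {x₀ : X} (k : ℕ) :
    ∀ {E : ℝ × X → G}, ContDiffAt ℝ ∞ E (0, x₀) → E =O[𝓝 (0, x₀)] (fun p => p.1 ^ k) →
      stateDeriv E =O[𝓝 (0, x₀)] fun p => p.1 ^ k := by
  induction k with
  | zero =>
    intro E hE _
    simpa using hE.stateDeriv.continuousAt.isBigO_one'
  | succ k ih =>
    intro E hE hO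
    refine isBigO_pow_succ_of_hasDerivAt (F' := stepDeriv (stateDeriv E)) ?_ ?_ ?_
    · have hι : Tendsto (fun x : X => ((0 : ℝ), x)) (𝓝 x₀) (𝓝 (0, x₀)) :=
        (Continuous.prodMk_right (0 : ℝ)).tendsto x₀
      filter_upwards [(eventually_eq_zero_of_isBigO hO).eventually_nhds,
        hι.eventually hE.eventually_differentiableAt] with x hx hd
      have h1 := (hasFDerivAt_stateDeriv hd).congr_of_eventuallyEq
        (f₁ := fun _ => (0 : G)) (hx.mono fun y hy => hy.symm)
      exact h1.unique (hasFDerivAt_const _ _)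
    · filter_upwards [hE.stateDeriv.eventually_differentiableAt] with p hp
      exact hasDerivAt_stepDeriv hp
    -- A step derivative costs one order; after exchanging the two derivatives, integration in the
    -- step size regains it.
    · refine (ih hE.stepDeriv (exists_leading_coefficient (k + 1) hE hO).2).congr' ?_
        EventuallyEq.rfl
      exact (eventually_stepDeriv_stateDeriv hE).mono fun p hp => hp.symm

theorem tendsto_neg_step {m : ℝ × X → X} {x₀ : X} (hm : Tendsto m (𝓝 (0, x₀)) (𝓝 x₀)) :
    Tendsto (fun p : ℝ × X => (-p.1, m p)) (𝓝 (0, x₀)) (𝓝 (0, x₀)) := by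
  refine Tendsto.prodMk_nhds ?_ hm
  exact Continuous.tendsto' (by fun_prop) _ _ (by simp)

theorem isBigO_comp_neg_step {F : ℝ × X → G} {m : ℝ × X → X} {x₀ : X} {k : ℕ}
    (hF : F =O[𝓝 (0, x₀)] fun p => p.1 ^ k) (hm : Tendsto m (𝓝 (0, x₀)) (𝓝 x₀)) :
    (fun p => F (-p.1, m p)) =O[𝓝 (0, x₀)] fun p => p.1 ^ k := by
  refine (hF.comp_tendsto (tendsto_neg_step hm)).trans (IsBigO.of_norm_left ?_)
  simpa [Function.comp_def] using (isBigO_refl (fun p : ℝ × X => p.1 ^ k) (𝓝 (0, x₀))).norm_left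

/-- A Lipschitz function of points that differ by `O(h ^ k)` differs by `O(h ^ k)`. -/
theorem ContDiffAt.isBigO_sub_comp {g : X → G} {x₀ : X} (hg : ContDiffAt ℝ 1 g x₀)
    {Y : Type*} {l : Filter Y} {a b : Y → X} (ha : Tendsto a l (𝓝 x₀)) (hb : Tendsto b l (𝓝 x₀)) :
    (fun y => g (a y) - g (b y)) =O[l] fun y => a y - b y :=
  (hg.hasStrictFDerivAt (by simp)).isBigO_sub.comp_tendsto (k := fun y => (a y, b y))
    (by rw [nhds_prod_eq]; exact ha.prodMk hb)

theorem contDiffAt_one_of_infty {g : X → G} {x : X} (hg : ContDiffAt ℝ ∞ g x) :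
    ContDiffAt ℝ 1 g x := hg.of_le (by simp)

/-- If `E = O(h ^ k)` and the leading terms of `E h` and of `(-1) ^ k • E (-h)` along a near-identity
map cancel, then `E = O(h ^ (k + 1))`. -/
theorem isBigO_succ_of_parity {E : ℝ × X → G} {m : ℝ × X → X} {x₀ : X} {k : ℕ}
    (hE : ContDiffAt ℝ ∞ E (0, x₀)) (hO : E =O[𝓝 (0, x₀)] fun p => p.1 ^ k)
    (hm : ContDiffAt ℝ ∞ m (0, x₀)) (hm0 : ∀ᶠ x in 𝓝 x₀, m (0, x) = x)
    (h : (fun p => E p + (-1 : ℝ) ^ k • E (-p.1, m p)) =O[𝓝 (0, x₀)] fun p => p.1 ^ (k + 1)) :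
    E =O[𝓝 (0, x₀)] fun p => p.1 ^ (k + 1) := by
  obtain ⟨⟨w, hw, hwO⟩, -⟩ := exists_leading_coefficient k hE hO
  have hmt : Tendsto m (𝓝 (0, x₀)) (𝓝 x₀) := by
    simpa [ContinuousAt, hm0.self_of_nhds] using hm.continuousAt
  have h1 := (isBigO_comp_neg_step hwO hmt).const_smul_left ((-1 : ℝ) ^ k)
  have hsnd : Tendsto (fun p : ℝ × X => p.2) (𝓝 (0, x₀)) (𝓝 x₀) :=
    continuous_snd.tendsto ((0 : ℝ), x₀)
  have hm1 : (fun p => m p - p.2) =O[𝓝 (0, x₀)] fun p : ℝ × X => p.1 ^ 1 :=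
    isBigO_pow_one_of_contDiffAt (hm.sub contDiffAt_snd) (hm0.mono fun x hx => by simp [hx])
  have h2 := ((contDiffAt_one_of_infty hw).isBigO_sub_comp hmt hsnd).trans hm1
  have h3 := (isBigO_refl (fun p : ℝ × X => p.1 ^ k) (𝓝 (0, x₀))).smul h2
  simp only [smul_eq_mul, ← pow_add] at h3
  have h4 := ((h.sub hwO).sub h1).sub h3
  have h5 : (fun p : ℝ × X => p.1 ^ k • (2 : ℝ) • w p.2) =O[𝓝 (0, x₀)] fun p => p.1 ^ (k + 1) := by
    refine h4.congr_left fun p => ?_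
    have hs : (-1 : ℝ) ^ k * (-p.1) ^ k = p.1 ^ k := by rw [← mul_pow]; simp
    simp only [smul_sub, smul_smul, Pi.smul_apply, hs]
    module
  have h6 := eventually_eq_zero_of_pow_smul (w := fun x => (2 : ℝ) • w x) h5
  refine hwO.congr' ?_ EventuallyEq.rfl
  filter_upwards [hsnd.eventually h6] with p hp
  simp [(smul_eq_zero_iff_right (two_ne_zero' ℝ)).1 hp]

/-- Taylor's formula of order two in the state, uniformly in the step size. -/
theorem exists_taylor_bound {F : ℝ × X → G} {x₀ : X} (hF : ContDiffAt ℝ ∞ F (0, x₀)) :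
    ∃ C : ℝ, ∃ ε > 0, ∀ (t : ℝ) (a e : X), |t| < ε → ‖a - x₀‖ < ε → ‖e‖ < ε →
      ‖F (t, a + e) - F (t, a) - stateDeriv F (t, a) e‖ ≤ C * ‖e‖ ^ 2 := by
  obtain ⟨K, s, hs, hK⟩ := (contDiffAt_one_of_infty hF.stateDeriv).exists_lipschitzOnWith
  obtain ⟨ε, hε, H⟩ := exists_ball_of_eventually
    (hF.eventually_differentiableAt.and (eventually_mem_set.2 hs))
  refine ⟨K, ε / 2, half_pos hε, fun t a e ht ha he => ?_⟩
  have hnear : ∀ z ∈ Metric.closedBall a ‖e‖, ‖z - x₀‖ < ε := fun z hz => by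
    have h1 : ‖z - a‖ ≤ ‖e‖ := by simpa [dist_eq_norm] using hz
    have h2 := norm_add_le (z - a) (a - x₀)
    rw [sub_add_sub_cancel] at h2
    linarith
  have ht' : |t| < ε := by linarith
  have ha' : a ∈ Metric.closedBall a ‖e‖ := by simp
  -- On the ball of radius `‖e‖` about `a` the state derivative varies by at most `K * ‖e‖`; the
  -- mean value inequality contributes the second factor `‖e‖`.
  have key := Convex.norm_image_sub_le_of_norm_hasFDerivWithin_le' (𝕜 := ℝ)
    (f := fun z => F (t, z)) (f' := fun z => stateDeriv F (t, z)) (s := Metric.closedBall a ‖e‖)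
    (φ := stateDeriv F (t, a)) (C := K * ‖e‖) (x := a) (y := a + e)
    (fun z hz => (hasFDerivAt_stateDeriv (H t z ht' (hnear z hz)).1).hasFDerivWithinAt)
    (fun z hz => by
      have h1 := hK.norm_sub_le (H t z ht' (hnear z hz)).2 (H t a ht' (hnear a ha')).2
      refine h1.trans (mul_le_mul_of_nonneg_left ?_ K.2)
      have h2 : ‖z - a‖ ≤ ‖e‖ := by simpa [dist_eq_norm] using hz
      simpa [Prod.norm_def] using h2)
    (convex_closedBall a ‖e‖) ha' (by simp)
  simp only [add_sub_cancel_left] at key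
  rw [sq, ← mul_assoc]
  exact key

theorem taylor_isBigO {F : ℝ × X → G} {x₀ : X} (hF : ContDiffAt ℝ ∞ F (0, x₀))
    {Z : Type*} {l : Filter Z} {t : Z → ℝ} {a e : Z → X} (ht : Tendsto t l (𝓝 0))
    (ha : Tendsto a l (𝓝 x₀)) (he : Tendsto e l (𝓝 0)) :
    (fun z => F (t z, a z + e z) - F (t z, a z) - stateDeriv F (t z, a z) (e z))
      =O[l] fun z => ‖e z‖ ^ 2 := by
  obtain ⟨C, ε, hε, H⟩ := exists_taylor_bound hF
  refine IsBigO.of_bound C ?_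
  filter_upwards [ht.eventually (Metric.ball_mem_nhds 0 hε),
    ha.eventually (Metric.ball_mem_nhds x₀ hε), he.eventually (Metric.ball_mem_nhds 0 hε)]
    with z h1 h2 h3
  have h4 := H (t z) (a z) (e z) (by simpa [Real.dist_eq] using h1)
    (by simpa [dist_eq_norm] using h2) (by simpa [dist_eq_norm] using h3)
  simpa using h4

theorem norm_sq_isBigO_pow {e : ℝ × X → G} {x₀ : X} {k : ℕ}
    (he : e =O[𝓝 (0, x₀)] fun p => p.1 ^ k) :
    (fun p => ‖e p‖ ^ 2) =O[𝓝 (0, x₀)] fun p => p.1 ^ (2 * k) := by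
  refine (he.norm_left.pow 2).congr_right fun p => ?_
  rw [← pow_mul, mul_comm]

theorem tendsto_zero_of_isBigO_pow {e : ℝ × X → G} {x₀ : X} {k : ℕ} (hk : k ≠ 0)
    (he : e =O[𝓝 (0, x₀)] fun p => p.1 ^ k) : Tendsto e (𝓝 (0, x₀)) (𝓝 0) :=
  he.trans_tendsto (Continuous.tendsto' (by fun_prop) _ _ (by simp [hk]))

/-- Smoothness gives `m_h - id = O(h)`, and this order survives differentiation in the state. -/
theorem stateDeriv_sub_id_isBigO {m : ℝ × X → X} {x₀ : X} (hm : ContDiffAt ℝ ∞ m (0, x₀))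
    (hm0 : ∀ᶠ x in 𝓝 x₀, m (0, x) = x) :
    (fun p => stateDeriv m p - ContinuousLinearMap.id ℝ X) =O[𝓝 (0, x₀)] fun p => p.1 ^ 1 := by
  have h1 := stateDeriv_isBigO 1 (hm.sub contDiffAt_snd)
    (isBigO_pow_one_of_contDiffAt (hm.sub contDiffAt_snd) (hm0.mono fun x hx => by simp [hx]))
  refine h1.congr' ?_ EventuallyEq.rfl
  filter_upwards [hm.eventually_differentiableAt] with p hp
  have h2 := (hasFDerivAt_stateDeriv (hp.sub differentiableAt_snd)).unique
    ((hasFDerivAt_stateDeriv hp).sub (hasFDerivAt_id p.2))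
  exact h2

/-- A near-identity map transports a displacement of order `k` up to order `k + 1`. -/
theorem displacement_isBigO {m : ℝ × X → X} {x₀ : X} (hm : ContDiffAt ℝ ∞ m (0, x₀))
    (hm0 : ∀ᶠ x in 𝓝 x₀, m (0, x) = x) {a e : ℝ × X → X} {k : ℕ}
    (ha : Tendsto a (𝓝 (0, x₀)) (𝓝 x₀)) (he : e =O[𝓝 (0, x₀)] fun p => p.1 ^ k) :
    (fun p => stateDeriv m (-p.1, a p) (e p) - e p) =O[𝓝 (0, x₀)] fun p => p.1 ^ (k + 1) := by
  have h1 := isBigO_comp_neg_step (stateDeriv_sub_id_isBigO hm hm0) ha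
  have h2 : (fun p => (stateDeriv m (-p.1, a p) - ContinuousLinearMap.id ℝ X) (e p))
      =O[𝓝 (0, x₀)] fun p => ‖stateDeriv m (-p.1, a p) - ContinuousLinearMap.id ℝ X‖ * ‖e p‖ :=
    IsBigO.of_bound 1 (Eventually.of_forall fun p => by
      simpa using (stateDeriv m (-p.1, a p) - ContinuousLinearMap.id ℝ X).le_opNorm (e p))
  refine (h2.trans (h1.norm_left.mul he.norm_left)).congr (fun p => by simp) fun p => ?_
  ring

end SmallStep

/-! ### The local flow: inversion, Lie series, and the parity argument for the order of a symmetric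
method. -/

section Flow

variable {d : ℕ} {f : RVec d → RVec d} {x₀ : RVec d} {φ : ℝ → RVec d → RVec d}

theorem IsLocalFlowAt.tendsto (h : IsLocalFlowAt f x₀ φ) :
    Tendsto (fun p : ℝ × RVec d => φ p.1 p.2) (𝓝 (0, x₀)) (𝓝 x₀) := by
  have h1 := h.2.self_of_nhds.1
  simpa [ContinuousAt, h1] using h.1

theorem IsLocalFlowAt.eventually_zero (h : IsLocalFlowAt f x₀ φ) : ∀ᶠ x in 𝓝 x₀, φ 0 x = x := by
  have ht : Tendsto (fun x : RVec d => ((0 : ℝ), x)) (𝓝 x₀) (𝓝 (0, x₀)) :=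
    (Continuous.prodMk_right (0 : ℝ)).tendsto x₀
  exact (ht.eventually h.2).mono fun x hx => hx.1

/-- The flow for time `-h` inverts the flow for time `h`. -/
theorem IsLocalFlowAt.eventually_neg (h : IsLocalFlowAt f x₀ φ) (hf : ContDiffAt ℝ 1 f x₀) :
    ∀ᶠ p : ℝ × RVec d in 𝓝 (0, x₀), φ (-p.1) (φ p.1 p.2) = p.2 := by
  obtain ⟨K, s, hs, hK⟩ := hf.exists_lipschitzOnWith
  obtain ⟨ε, hε, H⟩ := exists_ball_of_eventually (h.2.and (h.tendsto.eventually hs))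
  have hball : ∀ᶠ p : ℝ × RVec d in 𝓝 (0, x₀), ‖φ p.1 p.2 - x₀‖ < ε := by
    filter_upwards [h.tendsto.eventually (Metric.ball_mem_nhds x₀ hε)] with p hp
    simpa [dist_eq_norm] using hp
  filter_upwards [hball, Metric.ball_mem_nhds ((0 : ℝ), x₀) (half_pos hε)] with p hp1 hp2
  obtain ⟨t, x⟩ := p
  rw [Metric.mem_ball, Prod.dist_eq, max_lt_iff] at hp2
  have ht : |t| < ε / 2 := by simpa [Real.dist_eq] using hp2.1
  have hx : ‖x - x₀‖ < ε := by
    have : ‖x - x₀‖ < ε / 2 := by simpa [dist_eq_norm] using hp2.2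
    linarith
  simp only at hp1 ⊢
  have hab := abs_lt.1 ht
  -- Both `r ↦ φ_r(φ_t x)` and `r ↦ φ_{t+r} x` solve the equation with the same value at `r = 0`.
  -- They are compared at `r = -t`; the radius `ε / 2` keeps `|t + r| < ε`.
  have key := ODE_solution_unique_of_mem_Ioo (v := fun _ => f) (s := fun _ => s) (K := K)
    (f := fun r => φ r (φ t x)) (g := fun r => φ (t + r) x) (a := -(ε / 2)) (b := ε / 2) (t₀ := 0)
    (fun _ _ => hK) ⟨by linarith, by linarith⟩
    (fun r hr => by
      have h1 := H r (φ t x) (abs_lt.2 ⟨by linarith [hr.1], by linarith [hr.2]⟩) hp1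
      exact ⟨h1.1.2, h1.2⟩)
    (fun r hr => by
      have h1 := H (t + r) x (abs_lt.2 ⟨by linarith [hr.1], by linarith [hr.2]⟩) hx
      exact ⟨h1.1.2.comp_const_add t r, h1.2⟩)
    (by simpa using (H 0 (φ t x) (by simpa using hε) hp1).1.1)
  have h2 := key (x := -t) ⟨by linarith, by linarith⟩
  simp only [add_neg_cancel] at h2
  rw [h2]
  exact (H 0 x (by simpa using hε) hx).1.1

/-- The Lie series: a smooth function along the flow has Taylor expansions in the step size with
smooth coefficients. -/
theorem IsLocalFlowAt.exists_expansion {G : Type*} [NormedAddCommGroup G] [NormedSpace ℝ G]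
    (h : IsLocalFlowAt f x₀ φ) (hf : ContDiffAt ℝ ∞ f x₀) (N : ℕ) :
    ∀ {g : RVec d → G}, ContDiffAt ℝ ∞ g x₀ → ∃ c : ℕ → RVec d → G, (∀ j, ContDiffAt ℝ ∞ (c j) x₀) ∧
      (fun p : ℝ × RVec d => g (φ p.1 p.2) - ∑ j ∈ Finset.range N, p.1 ^ j • c j p.2)
        =O[𝓝 (0, x₀)] fun p => p.1 ^ N := by
  induction N with
  | zero =>
    intro g hg
    refine ⟨fun _ _ => 0, fun _ => contDiffAt_const, ?_⟩
    simpa using (hg.continuousAt.tendsto.comp h.tendsto).isBigO_one ℝ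
  | succ N ih =>
    intro g hg
    -- The step derivative of `g ∘ φ_h` is the Lie derivative `Dg · f` along the flow. Its expansion
    -- is integrated term by term, with `g` as the constant of integration.
    obtain ⟨c, hc, hO⟩ := ih (g := fun x => fderiv ℝ g x (f x)) (hg.fderiv_infty.clm_apply hf)
    refine ⟨fun j => Nat.casesOn j g fun i x => ((i : ℝ) + 1)⁻¹ • c i x, fun j => ?_, ?_⟩
    · cases j with
      | zero => exact hg
      | succ i => exact contDiffAt_const.smul (hc i)
    refine isBigO_pow_succ_of_hasDerivAt ?_ ?_ hO
    · filter_upwards [h.eventually_zero] with x hx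
      simp [Finset.sum_range_succ', hx]
    · filter_upwards [h.2, h.tendsto.eventually hg.eventually_differentiableAt] with p hp hd
      have h1 := hd.hasFDerivAt.comp_hasDerivAt p.1 hp.2
      have h2 := HasDerivAt.fun_sum (u := Finset.range N)
        (fun j _ => hasDerivAt_pow_smul j (c j p.2) p.1)
      convert (h1.sub (h2.add_const (g p.2))) using 1
      funext t
      simp [Finset.sum_range_succ', smul_smul, div_eq_mul_inv]

/-- The flow agrees to any order with a smooth function of step size and state. -/
theorem IsLocalFlowAt.exists_smooth_approximation (h : IsLocalFlowAt f x₀ φ)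
    (hf : ContDiffAt ℝ ∞ f x₀) (N : ℕ) :
    ∃ P : ℝ × RVec d → RVec d, ContDiffAt ℝ ∞ P (0, x₀) ∧
      (fun p : ℝ × RVec d => φ p.1 p.2 - P p) =O[𝓝 (0, x₀)] fun p => p.1 ^ N := by
  obtain ⟨c, hc, hO⟩ := h.exists_expansion hf N (g := fun x => x) contDiffAt_id
  refine ⟨_, ContDiffAt.sum fun j _ => ?_, hO⟩
  exact (contDiffAt_fst.pow j).smul (ContDiffAt.comp (g := c j) ((0 : ℝ), x₀) (hc j) contDiffAt_snd)

/-- A method of order `k - 1` with `k` even whose adjoint agrees with it to order `k` has order `k`. -/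
theorem isBigO_sub_flow_succ {u : ℝ × RVec d → RVec d} {k : ℕ} (h : IsLocalFlowAt f x₀ φ)
    (hf : ContDiffAt ℝ ∞ f x₀) (hu : ContDiffAt ℝ ∞ u (0, x₀))
    (hu0 : ∀ᶠ x in 𝓝 x₀, u (0, x) = x) (hk : Even k) (hk0 : k ≠ 0)
    (hO : (fun p : ℝ × RVec d => u p - φ p.1 p.2) =O[𝓝 (0, x₀)] fun p => p.1 ^ k)
    (hs : (fun p : ℝ × RVec d => u (-p.1, u p) - p.2) =O[𝓝 (0, x₀)] fun p => p.1 ^ (k + 1)) :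
    (fun p : ℝ × RVec d => u p - φ p.1 p.2) =O[𝓝 (0, x₀)] fun p => p.1 ^ (k + 1) := by
  -- `IsLocalFlowAt` does not include joint smoothness in step size and state, which the parity
  -- argument needs; the truncated Lie series `P` stands in for the flow.
  obtain ⟨P, hP, hPO⟩ := h.exists_smooth_approximation hf (k + 1)
  have hut : Tendsto u (𝓝 (0, x₀)) (𝓝 x₀) := by
    simpa [ContinuousAt, hu0.self_of_nhds] using hu.continuousAt
  have hE : (fun p => u p - P p) =O[𝓝 (0, x₀)] fun p => p.1 ^ k :=
    (hO.add (isBigO_pow_mono (Nat.le_succ k) hPO)).congr_left fun p => by simp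
  suffices hmain : (fun p => u p - P p) =O[𝓝 (0, x₀)] fun p => p.1 ^ (k + 1) from
    (hmain.sub hPO).congr_left fun p => by simp
  refine isBigO_succ_of_parity (hu.sub hP) hE hu hu0 ?_
  have hneg : Tendsto (fun p : ℝ × RVec d => -p.1) (𝓝 (0, x₀)) (𝓝 0) :=
    Continuous.tendsto' (by fun_prop) _ _ (by simp)
  have hP0 : ∀ᶠ x in 𝓝 x₀, P (0, x) = x := by
    filter_upwards [eventually_eq_zero_of_isBigO hPO, h.eventually_zero] with x h1 h2
    simp only [h2] at h1
    exact (sub_eq_zero.1 h1).symm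
  have hO' : (fun p : ℝ × RVec d => φ p.1 p.2 - u p) =O[𝓝 (0, x₀)] fun p => p.1 ^ k :=
    hO.neg_left.congr_left fun p => by simp
  have h1 := (taylor_isBigO hP hneg hut (tendsto_zero_of_isBigO_pow hk0 hO')).trans
    (isBigO_pow_mono (show k + 1 ≤ 2 * k by omega) (norm_sq_isBigO_pow hO'))
  have h2 := displacement_isBigO hP hP0 hut hO'
  have h3 := isBigO_comp_neg_step hPO h.tendsto
  have h4 := h.eventually_neg (contDiffAt_one_of_infty hf)
  -- With `E = u - P` and even `k`, the sum `E_h + E_{-h}(u_h)` telescopes through `u_{-h}(u_h) ≈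
  -- x`, `φ_{-h}(φ_h) = x` and `P_{-h}(φ_h) - P_{-h}(u_h) ≈ φ_h - u_h`.
  refine ((((hs.add h1).add h2).add hPO).add h3).congr' ?_ EventuallyEq.rfl
  filter_upwards [h4] with p hp
  simp only [hp, hk.neg_one_pow, one_smul, add_sub_cancel]
  abel

end Flow

/-! ### Transfer of identities from real to complex step sizes and states. -/

section Complexification

variable {d : ℕ}

/-- The inclusion of `ℝ^d` in `ℂ^d` as a continuous linear map. -/
noncomputable def toComplexL (d : ℕ) : RVec d →L[ℝ] CVec d :=
  ContinuousLinearMap.pi fun i => Complex.ofRealCLM.comp (ContinuousLinearMap.proj i)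

/-- The real part as a continuous linear map. -/
noncomputable def realPartL (d : ℕ) : CVec d →L[ℝ] RVec d :=
  ContinuousLinearMap.pi fun i => Complex.reCLM.comp (ContinuousLinearMap.proj i)

/-- The imaginary part as a continuous linear map. -/
noncomputable def imagPartL (d : ℕ) : CVec d →L[ℝ] RVec d :=
  ContinuousLinearMap.pi fun i => Complex.imCLM.comp (ContinuousLinearMap.proj i)

@[simp] theorem toComplexL_apply (x : RVec d) : toComplexL d x = toComplex x := rfl

@[simp] theorem toComplex_apply (x : RVec d) (i : Fin d) : toComplex x i = (x i : ℂ) := rfl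

@[simp] theorem realPartL_apply (z : CVec d) (i : Fin d) : realPartL d z i = (z i).re := rfl

@[simp] theorem imagPartL_apply (z : CVec d) (i : Fin d) : imagPartL d z i = (z i).im := rfl

@[simp] theorem realPartL_toComplex (x : RVec d) : realPartL d (toComplex x) = x := by
  ext i; simp

@[simp] theorem imagPartL_toComplex (x : RVec d) : imagPartL d (toComplex x) = 0 := by
  ext i; simp

theorem star_toComplex (x : RVec d) : star (toComplex x) = toComplex x := by
  ext i; simp

theorem toComplex_realPartL_add (z : CVec d) :
    toComplex (realPartL d z) + Complex.I • toComplex (imagPartL d z) = z := by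
  ext i
  simp [mul_comm Complex.I, Complex.re_add_im]

theorem star_eq_realPartL_sub (z : CVec d) :
    star z = toComplex (realPartL d z) - Complex.I • toComplex (imagPartL d z) := by
  ext i
  apply Complex.ext <;> simp

/-- The inclusion of real step sizes and states in complex ones. -/
noncomputable def pairToComplexL (d : ℕ) : ℝ × RVec d →L[ℝ] ℂ × CVec d :=
  Complex.ofRealCLM.prodMap (toComplexL d)

@[simp] theorem pairToComplexL_apply (p : ℝ × RVec d) :
    pairToComplexL d p = ((p.1 : ℂ), toComplex p.2) := rfl

theorem pairToComplexL_zero (x : RVec d) :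
    pairToComplexL d (0, x) = (0, toComplex x) := by simp

/-- A function that is holomorphic on complexified real lines near a real point and vanishes at the
real points vanishes near the real point. -/
theorem eventually_eq_zero_of_real {G : Type*} [NormedAddCommGroup G] [NormedSpace ℂ G]
    [CompleteSpace G] {F : ℂ × CVec d → G} {x₀ : RVec d}
    (hF : ∀ᶠ z in 𝓝 ((0 : ℂ), toComplex x₀), ∀ (a b : ℝ × RVec d) (ζ : ℂ),
      pairToComplexL d a + ζ • pairToComplexL d b = z →
        DifferentiableAt ℂ (fun ζ => F (pairToComplexL d a + ζ • pairToComplexL d b)) ζ)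
    (h0 : ∀ᶠ p in 𝓝 ((0 : ℝ), x₀), F (pairToComplexL d p) = 0) :
    ∀ᶠ z in 𝓝 ((0 : ℂ), toComplex x₀), F z = 0 := by
  obtain ⟨ε, hε, hF'⟩ := Metric.eventually_nhds_iff_ball.1 hF
  obtain ⟨δ, hδ, h0'⟩ := Metric.eventually_nhds_iff_ball.1 h0
  let re : ℂ × CVec d → ℝ × RVec d := fun z => (z.1.re, realPartL d z.2)
  let im : ℂ × CVec d → ℝ × RVec d := fun z => (z.1.im, imagPartL d z.2)
  have hre : Continuous re := by fun_prop
  have him : Continuous im := by fun_prop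
  have e1 : ∀ᶠ z in 𝓝 ((0 : ℂ), toComplex x₀),
      dist (pairToComplexL d (re z)) (0, toComplex x₀) < ε / 2 := by
    refine ((pairToComplexL d).continuous.comp hre).tendsto' _ _ ?_ |>.eventually
      (Metric.ball_mem_nhds _ (half_pos hε))
    simp [re]
  have e2 : ∀ᶠ z in 𝓝 ((0 : ℂ), toComplex x₀), dist (pairToComplexL d (im z)) 0 < ε / 4 := by
    refine ((pairToComplexL d).continuous.comp him).tendsto' _ _ ?_ |>.eventually
      (Metric.ball_mem_nhds _ (by positivity))
    simp [im, toComplex, Prod.ext_iff, funext_iff]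
  have e3 : ∀ᶠ z in 𝓝 ((0 : ℂ), toComplex x₀), dist (re z) (0, x₀) < δ / 2 := by
    refine hre.tendsto' _ _ ?_ |>.eventually (Metric.ball_mem_nhds _ (half_pos hδ))
    simp [re]
  have e4 : ∀ᶠ z in 𝓝 ((0 : ℂ), toComplex x₀), dist (im z) 0 < δ / 4 := by
    refine him.tendsto' _ _ ?_ |>.eventually (Metric.ball_mem_nhds _ (by positivity))
    simp [im]
  filter_upwards [e1, e2, e3, e4] with z h1 h2 h3 h4
  set a := re z
  set b := im z
  have hz : pairToComplexL d a + Complex.I • pairToComplexL d b = z := by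
    refine Prod.ext ?_ (toComplex_realPartL_add z.2)
    simp [a, b, re, im, mul_comm Complex.I, Complex.re_add_im]
  -- The point `z = a + i b` lies on the complexified real line through `a` with direction `b`. On
  -- the disc of radius 2, which contains `ζ = i`, the function `g` is holomorphic and vanishes at
  -- real `ζ`, hence also at `i`.
  let g : ℂ → G := fun ζ => F (pairToComplexL d a + ζ • pairToComplexL d b)
  have hd : DifferentiableOn ℂ g (Metric.ball 0 2) := by
    intro ζ hζ
    refine (hF' (pairToComplexL d a + ζ • pairToComplexL d b) ?_ a b ζ rfl).differentiableWithinAt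
    rw [mem_ball_zero_iff] at hζ
    rw [dist_zero_right] at h2
    rw [dist_eq_norm] at h1
    rw [mem_ball_iff_norm, add_sub_right_comm]
    refine (norm_add_le _ _).trans_lt ?_
    rw [norm_smul]
    nlinarith [norm_nonneg (pairToComplexL d b), norm_nonneg ζ]
  have ha := hd.analyticOnNhd Metric.isOpen_ball
  have hreal : ∀ r : ℝ, |r| < 2 → g r = 0 := by
    intro r hr
    have hcast : pairToComplexL d a + (r : ℂ) • pairToComplexL d b
        = pairToComplexL d (a + r • b) := by
      rw [map_add, map_smul, Complex.coe_smul]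
    simp only [g, hcast]
    refine h0' _ ?_
    rw [dist_zero_right] at h4
    rw [dist_eq_norm] at h3
    rw [mem_ball_iff_norm, add_sub_right_comm]
    refine (norm_add_le _ _).trans_lt ?_
    rw [norm_smul, Real.norm_eq_abs]
    nlinarith [norm_nonneg b, abs_nonneg r]
  have hfreq : ∃ᶠ ζ in 𝓝[≠] (0 : ℂ), g ζ = (fun _ => (0 : G)) ζ := by
    have ht : Tendsto (fun r : ℝ => (r : ℂ)) (𝓝[≠] 0) (𝓝[≠] 0) := by
      refine tendsto_nhdsWithin_of_tendsto_nhds_of_eventually_within _ ?_ ?_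
      · exact (Complex.continuous_ofReal.tendsto' 0 0 (by simp)).mono_left nhdsWithin_le_nhds
      · filter_upwards [self_mem_nhdsWithin] with r hr
        simpa using hr
    refine ht.frequently (Eventually.frequently ?_)
    filter_upwards [mem_nhdsWithin_of_mem_nhds (Metric.ball_mem_nhds (0 : ℝ) two_pos)] with r hr
    exact hreal r (by simpa [Real.dist_eq] using hr)
  have key : g Complex.I = 0 := ha.eqOn_of_preconnected_of_frequently_eq analyticOnNhd_const
    (convex_ball 0 2).isPreconnected (by simp) hfreq (x := Complex.I) (by simp)
  rw [← hz]
  exact key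

theorem eventually_eq_zero_of_analyticAt {G : Type*} [NormedAddCommGroup G] [NormedSpace ℂ G]
    [CompleteSpace G] {F : ℂ × CVec d → G} {x₀ : RVec d}
    (hF : AnalyticAt ℂ F (0, toComplex x₀))
    (h0 : ∀ᶠ p in 𝓝 ((0 : ℝ), x₀), F (pairToComplexL d p) = 0) :
    ∀ᶠ z in 𝓝 ((0 : ℂ), toComplex x₀), F z = 0 := by
  refine eventually_eq_zero_of_real ?_ h0
  filter_upwards [hF.eventually_analyticAt] with z hz a b ζ hζ
  subst hζ
  exact hz.differentiableAt.comp ζ (f := fun ζ : ℂ => pairToComplexL d a + ζ • pairToComplexL d b)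
    (by fun_prop)

theorem tendsto_pairToComplexL (x₀ : RVec d) :
    Tendsto (pairToComplexL d) (𝓝 (0, x₀)) (𝓝 (0, toComplex x₀)) :=
  (pairToComplexL d).continuous.tendsto' _ _ (by simp)

section Method

variable {D : Set (RVec d)} {f : RVec d → RVec d} {S : ℝ → RVec d → RVec d}
  {Sc : ℂ → CVec d → CVec d} {x₀ : RVec d}

theorem eventually_zero_of_hasOrder {r : ℕ} (h : HasOrder f D S r) (hx₀ : x₀ ∈ D) :
    ∀ᶠ x in 𝓝 x₀, S 0 x = x := by
  obtain ⟨φ, hφ, hO⟩ := h x₀ hx₀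
  filter_upwards [eventually_eq_zero_of_isBigO hO, hφ.eventually_zero] with x h1 h2
  simpa [h2, sub_eq_zero] using h1

/-- The extension of a consistent method to complex states is the identity for step size `0`. -/
theorem IsHolomorphicExtension.eventually_zero (hext : IsHolomorphicExtension D S Sc)
    (hx₀ : x₀ ∈ D) (h0 : ∀ᶠ x in 𝓝 x₀, S 0 x = x) :
    ∀ᶠ z in 𝓝 (toComplex x₀), Sc 0 z = z := by
  obtain ⟨hA, hS⟩ := hext x₀ hx₀
  have hz : Tendsto (fun z : ℂ × CVec d => ((0 : ℂ), z.2)) (𝓝 (0, toComplex x₀))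
      (𝓝 (0, toComplex x₀)) := Continuous.tendsto' (by fun_prop) _ _ rfl
  have hF : AnalyticAt ℂ (fun z : ℂ × CVec d => Sc 0 z.2 - z.2) (0, toComplex x₀) := by
    refine AnalyticAt.sub ?_ analyticAt_snd
    exact AnalyticAt.fun_comp (g := fun p : ℂ × CVec d => Sc p.1 p.2)
      (f := fun z : ℂ × CVec d => ((0 : ℂ), z.2)) hA (analyticAt_const.prod analyticAt_snd)
  have h1 := eventually_eq_zero_of_analyticAt hF (by
    have hr : Tendsto (fun p : ℝ × RVec d => ((0 : ℝ), p.2)) (𝓝 (0, x₀)) (𝓝 (0, x₀)) :=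
      Continuous.tendsto' (by fun_prop) _ _ rfl
    filter_upwards [hr.eventually hS, (continuous_snd.tendsto ((0 : ℝ), x₀)).eventually h0]
      with p hp hp0
    simp only [hp0, Complex.ofReal_zero] at hp
    simp [hp])
  have h2 : Tendsto (fun z : CVec d => ((0 : ℂ), z)) (𝓝 (toComplex x₀)) (𝓝 (0, toComplex x₀)) :=
    Continuous.tendsto' (by fun_prop) _ _ rfl
  exact (h2.eventually h1).mono fun z hz => sub_eq_zero.1 hz

theorem tendsto_of_analyticAt {Φ : ℂ × CVec d → CVec d} (hA : AnalyticAt ℂ Φ (0, toComplex x₀))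
    (h0 : Φ (0, toComplex x₀) = toComplex x₀) :
    Tendsto Φ (𝓝 (0, toComplex x₀)) (𝓝 (toComplex x₀)) := by
  simpa [ContinuousAt, h0] using hA.continuousAt

/-- The extension of a time-symmetric method is time-symmetric. -/
theorem IsHolomorphicExtension.eventually_symm (hext : IsHolomorphicExtension D S Sc)
    (hx₀ : x₀ ∈ D) (h0 : ∀ᶠ x in 𝓝 x₀, S 0 x = x) (hsymm : IsTimeSymmetric D S) :
    ∀ᶠ z in 𝓝 ((0 : ℂ), toComplex x₀), Sc (-z.1) (Sc z.1 z.2) = z.2 := by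
  obtain ⟨hA, hS⟩ := hext x₀ hx₀
  have hz := (hext.eventually_zero hx₀ h0).self_of_nhds
  have hin : AnalyticAt ℂ (fun z : ℂ × CVec d => (-z.1, Sc z.1 z.2)) (0, toComplex x₀) :=
    analyticAt_fst.neg.prod hA
  have hF : AnalyticAt ℂ (fun z : ℂ × CVec d => Sc (-z.1) (Sc z.1 z.2) - z.2)
      (0, toComplex x₀) := by
    refine AnalyticAt.sub ?_ analyticAt_snd
    refine AnalyticAt.fun_comp (g := fun p : ℂ × CVec d => Sc p.1 p.2)
      (f := fun z : ℂ × CVec d => (-z.1, Sc z.1 z.2)) ?_ hin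
    simpa [hz] using hA
  have ht : Tendsto (fun p : ℝ × RVec d => S p.1 p.2) (𝓝 (0, x₀)) (𝓝 x₀) := by
    have h1 := ((realPartL d).continuous.tendsto _).comp
      ((tendsto_of_analyticAt hA hz).comp (tendsto_pairToComplexL x₀))
    rw [realPartL_toComplex] at h1
    refine h1.congr' (hS.mono fun p hp => ?_)
    simp [hp]
  refine (eventually_eq_zero_of_analyticAt hF ?_).mono fun z hz => sub_eq_zero.1 hz
  filter_upwards [hS, (tendsto_neg_step ht).eventually hS, hsymm x₀ hx₀] with p h1 h2 h3
  simp only [pairToComplexL_apply, h1]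
  rw [← Complex.ofReal_neg, h2, h3, sub_self]

/-- The extension of a real method commutes with complex conjugation. -/
theorem IsHolomorphicExtension.eventually_star (hext : IsHolomorphicExtension D S Sc)
    (hx₀ : x₀ ∈ D) :
    ∀ᶠ z in 𝓝 ((0 : ℂ), toComplex x₀), Sc (star z.1) (star z.2) = star (Sc z.1 z.2) := by
  obtain ⟨hA, hS⟩ := hext x₀ hx₀
  have hst : Tendsto (fun z : ℂ × CVec d => star z) (𝓝 (0, toComplex x₀))
      (𝓝 (0, toComplex x₀)) :=
    continuous_star.tendsto' _ _ (Prod.ext (by simp) (star_toComplex x₀))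
  have hline : ∀ (a b : ℝ × RVec d) (ζ : ℂ), star (pairToComplexL d a + ζ • pairToComplexL d b)
      = pairToComplexL d a + star ζ • pairToComplexL d b := by
    intro a b ζ
    refine Prod.ext (by simp) ?_
    ext i
    simp
  have hpt := hA.eventually_analyticAt.mono fun z hz => hz.differentiableAt
  have h1 : ∀ᶠ z in 𝓝 ((0 : ℂ), toComplex x₀),
      star (Sc (star z.1) (star z.2)) - Sc z.1 z.2 = 0 := by
    -- On a complexified real line, conjugating the state amounts to conjugating `ζ`. The first term
    -- is thus conjugation before and after a holomorphic function of `ζ`, hence holomorphic; this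
    -- is why holomorphy is only asked along such lines.
    refine eventually_eq_zero_of_real ?_ ?_
    · filter_upwards [hpt, hst.eventually hpt] with z h1 h2 a b ζ hζ
      subst hζ
      rw [hline] at h2
      have hlin : ∀ ζ, DifferentiableAt ℂ
          (fun ζ : ℂ => pairToComplexL d a + ζ • pairToComplexL d b) ζ := by fun_prop
      refine DifferentiableAt.sub ?_ (DifferentiableAt.comp ζ
        (g := fun p : ℂ × CVec d => Sc p.1 p.2)
        (f := fun ζ : ℂ => pairToComplexL d a + ζ • pairToComplexL d b) h1 (hlin ζ))
      have h3 := (h2.comp (star ζ) (hlin _)).star_conj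
      simp only [starRingEnd_apply, star_star] at h3
      refine h3.congr_of_eventuallyEq (Eventually.of_forall fun η => ?_)
      simp only [Function.comp_apply, starRingEnd_apply]
      rw [← hline]
      rfl
    · filter_upwards [hS] with p hp
      have := star_toComplex p.2
      simp [this, hp, star_toComplex]
  filter_upwards [h1] with z hz
  rw [sub_eq_zero] at hz
  rw [← hz, star_star]

end Method

end Complexification

/-! ### Compositions of complex substeps: inversion, conjugation and symplecticity. -/

section Composition

variable {d : ℕ} {Sc : ℂ → CVec d → CVec d} {x₀ : RVec d}

/-- The composition of the substeps listed in `l`, the head of the list acting first. -/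
def listComposition (Sc : ℂ → CVec d → CVec d) (l : List ℂ) (h : ℂ) (z : CVec d) : CVec d :=
  l.foldl (fun y a => Sc (a * h) y) z

theorem listComposition_cons (a : ℂ) (l : List ℂ) (h : ℂ) (z : CVec d) :
    listComposition Sc (a :: l) h z = listComposition Sc l h (Sc (a * h) z) := rfl

theorem listComposition_concat (a : ℂ) (l : List ℂ) (h : ℂ) (z : CVec d) :
    listComposition Sc (l ++ [a]) h z = Sc (a * h) (listComposition Sc l h z) := by
  simp [listComposition]

theorem tendsto_scale (a : ℂ) (z₀ : CVec d) :
    Tendsto (fun p : ℂ × CVec d => (a * p.1, p.2)) (𝓝 (0, z₀)) (𝓝 (0, z₀)) :=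
  Continuous.tendsto' (by fun_prop) _ _ (by simp)

theorem analyticAt_substep (hA : AnalyticAt ℂ (fun p : ℂ × CVec d => Sc p.1 p.2) (0, toComplex x₀))
    (a : ℂ) : AnalyticAt ℂ (fun p : ℂ × CVec d => Sc (a * p.1) p.2) (0, toComplex x₀) := by
  refine AnalyticAt.fun_comp (g := fun p : ℂ × CVec d => Sc p.1 p.2)
    (f := fun p : ℂ × CVec d => (a * p.1, p.2)) ?_
    ((analyticAt_const.mul analyticAt_fst).prod analyticAt_snd)
  simpa using hA

theorem tendsto_substep (hA : AnalyticAt ℂ (fun p : ℂ × CVec d => Sc p.1 p.2) (0, toComplex x₀))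
    (h0 : Sc 0 (toComplex x₀) = toComplex x₀) (a : ℂ) :
    Tendsto (fun p : ℂ × CVec d => (p.1, Sc (a * p.1) p.2)) (𝓝 (0, toComplex x₀))
      (𝓝 (0, toComplex x₀)) :=
  (continuous_fst.tendsto _).prodMk_nhds
    (tendsto_of_analyticAt (analyticAt_substep hA a) (by simpa using h0))

theorem listComposition_analyticAt
    (hA : AnalyticAt ℂ (fun p : ℂ × CVec d => Sc p.1 p.2) (0, toComplex x₀))
    (h0 : Sc 0 (toComplex x₀) = toComplex x₀) (l : List ℂ) :
    AnalyticAt ℂ (fun p : ℂ × CVec d => listComposition Sc l p.1 p.2) (0, toComplex x₀) := by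
  induction l with
  | nil => exact analyticAt_snd
  | cons a l ih =>
    refine AnalyticAt.fun_comp (g := fun p : ℂ × CVec d => listComposition Sc l p.1 p.2)
      (f := fun p : ℂ × CVec d => (p.1, Sc (a * p.1) p.2)) ?_
      (analyticAt_fst.prod (analyticAt_substep hA a))
    simpa [h0] using ih

theorem listComposition_zero {z : CVec d} (h0 : Sc 0 z = z) (l : List ℂ) :
    listComposition Sc l 0 z = z := by
  induction l with
  | nil => rfl
  | cons a l ih => rw [listComposition_cons, mul_zero, h0, ih]

/-- Undoing the substeps in the opposite order inverts the composition, each `Sc (a * h)` being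
undone by `Sc (-(a * h))`. -/
theorem eventually_listComposition_reverse
    (hA : AnalyticAt ℂ (fun p : ℂ × CVec d => Sc p.1 p.2) (0, toComplex x₀))
    (h0 : Sc 0 (toComplex x₀) = toComplex x₀)
    (hs : ∀ᶠ z in 𝓝 ((0 : ℂ), toComplex x₀), Sc (-z.1) (Sc z.1 z.2) = z.2) (l : List ℂ) :
    ∀ᶠ z in 𝓝 ((0 : ℂ), toComplex x₀),
      listComposition Sc l.reverse (-z.1) (listComposition Sc l z.1 z.2) = z.2 := by
  induction l with
  | nil => exact Eventually.of_forall fun _ => rfl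
  | cons a l ih =>
    filter_upwards [(tendsto_substep hA h0 a).eventually ih,
      (tendsto_scale a (toComplex x₀)).eventually hs] with z h1 h2
    rw [List.reverse_cons, listComposition_concat, listComposition_cons]
    rw [h1, mul_neg, h2]

theorem eventually_listComposition_star
    (hA : AnalyticAt ℂ (fun p : ℂ × CVec d => Sc p.1 p.2) (0, toComplex x₀))
    (h0 : Sc 0 (toComplex x₀) = toComplex x₀)
    (hs : ∀ᶠ z in 𝓝 ((0 : ℂ), toComplex x₀), Sc (star z.1) (star z.2) = star (Sc z.1 z.2))
    (l : List ℂ) :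
    ∀ᶠ z in 𝓝 ((0 : ℂ), toComplex x₀),
      listComposition Sc (l.map star) (star z.1) (star z.2)
        = star (listComposition Sc l z.1 z.2) := by
  induction l with
  | nil => exact Eventually.of_forall fun _ => rfl
  | cons a l ih =>
    filter_upwards [(tendsto_substep hA h0 a).eventually ih,
      (tendsto_scale a (toComplex x₀)).eventually hs] with z h1 h2
    rw [List.map_cons, listComposition_cons, listComposition_cons, ← h1, ← star_mul', h2]

/-- This is the only form in which the symmetry of the coefficients enters: it identifies the
inverse, a reversed composition, with a conjugated one. -/
theorem IsSymmetricConjugate.reverse_ofFn {s : ℕ} {α : Fin s → ℂ} (hα : IsSymmetricConjugate α) :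
    (List.ofFn α).reverse = (List.ofFn α).map star := by
  refine List.ext_getElem (by simp) fun i h1 h2 => ?_
  have hi : i < s := by simpa using h1
  simp only [List.getElem_reverse, List.getElem_ofFn, List.getElem_map, List.length_ofFn]
  have := hα ⟨i, hi⟩
  rw [starRingEnd_apply] at this
  rw [← this]
  congr 1
  ext
  simp [Fin.rev]
  omega

/-- A symmetric-conjugate composition of a time-symmetric real method is inverted by its complex
conjugate with the opposite step size. -/
theorem eventually_listComposition_neg_star {l : List ℂ} (hl : l.reverse = l.map star)
    (hA : AnalyticAt ℂ (fun p : ℂ × CVec d => Sc p.1 p.2) (0, toComplex x₀))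
    (h0 : Sc 0 (toComplex x₀) = toComplex x₀)
    (hs : ∀ᶠ z in 𝓝 ((0 : ℂ), toComplex x₀), Sc (-z.1) (Sc z.1 z.2) = z.2)
    (hst : ∀ᶠ z in 𝓝 ((0 : ℂ), toComplex x₀), Sc (star z.1) (star z.2) = star (Sc z.1 z.2)) :
    ∀ᶠ p : ℝ × RVec d in 𝓝 (0, x₀),
      listComposition Sc l (-p.1 : ℂ) (star (listComposition Sc l p.1 (toComplex p.2)))
        = toComplex p.2 := by
  have hr := tendsto_pairToComplexL x₀
  have hΨ := tendsto_of_analyticAt (listComposition_analyticAt hA h0 l) (listComposition_zero h0 l)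
  have hΨ' : Tendsto (fun p : ℝ × RVec d =>
      (-(p.1 : ℂ), star (listComposition Sc l p.1 (toComplex p.2)))) (𝓝 (0, x₀))
      (𝓝 (0, toComplex x₀)) := by
    refine Tendsto.prodMk_nhds (Continuous.tendsto' (by fun_prop) _ _ (by simp)) ?_
    have := (continuous_star.tendsto _).comp (hΨ.comp hr)
    rwa [star_toComplex] at this
  filter_upwards [hr.eventually (eventually_listComposition_reverse hA h0 hs l),
    hΨ'.eventually (eventually_listComposition_star hA h0 hst l)] with p h1 h2
  -- Now `h1` inverts `ψ_h` by the composition with conjugate coefficients and step `-h`, while `h2`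
  -- writes that composition as the conjugate of `ψ_{-h}` at the conjugate state. Conjugating once
  -- more gives the claim.
  rw [hl] at h1
  simp only [pairToComplexL_apply, star_star, star_neg] at h1 h2
  have hp : star (p.1 : ℂ) = p.1 := Complex.conj_ofReal p.1
  rw [hp, h1] at h2
  rw [← star_star (listComposition Sc l (-p.1 : ℂ) _), ← h2, star_toComplex]

/-- The Jacobian matrix of a holomorphic method with respect to the state. -/
noncomputable def complexJacobian (Φ : ℂ × CVec d → CVec d) (p : ℂ × CVec d) :
    Matrix (Fin d) (Fin d) ℂ :=
  LinearMap.toMatrix' ((fderiv ℂ Φ p).comp (ContinuousLinearMap.inr ℂ ℂ (CVec d)) :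
    CVec d →ₗ[ℂ] CVec d)

theorem complexJacobian_apply (Φ : ℂ × CVec d → CVec d) (p : ℂ × CVec d) (i j : Fin d) :
    complexJacobian Φ p i j = fderiv ℂ Φ p (0, Pi.single j 1) i := by
  simp [complexJacobian, LinearMap.toMatrix'_apply]

theorem complexJacobian_comp {Φ Θ : ℂ × CVec d → CVec d} {p : ℂ × CVec d}
    (hΦ : DifferentiableAt ℂ Φ (p.1, Θ p)) (hΘ : DifferentiableAt ℂ Θ p) :
    complexJacobian (fun p => Φ (p.1, Θ p)) p
      = complexJacobian Φ (p.1, Θ p) * complexJacobian Θ p := by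
  rw [complexJacobian, complexJacobian, complexJacobian, ← LinearMap.toMatrix'_comp]
  congr 1
  have h1 := hΦ.hasFDerivAt.comp p (f := fun p : ℂ × CVec d => (p.1, Θ p))
    (hasFDerivAt_fst.prodMk hΘ.hasFDerivAt)
  have h2 : fderiv ℂ (fun p => Φ (p.1, Θ p)) p = _ := h1.fderiv
  refine LinearMap.ext fun v => ?_
  simp [h2]

theorem complexJacobian_substep {p : ℂ × CVec d} {a : ℂ}
    (h : DifferentiableAt ℂ (fun p : ℂ × CVec d => Sc p.1 p.2) (a * p.1, p.2)) :
    complexJacobian (fun p => Sc (a * p.1) p.2) p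
      = complexJacobian (fun p => Sc p.1 p.2) (a * p.1, p.2) := by
  rw [complexJacobian, complexJacobian]
  congr 1
  have h1 := h.hasFDerivAt.comp p (f := fun p : ℂ × CVec d => (a * p.1, p.2))
    ((hasFDerivAt_fst.const_mul a).prodMk hasFDerivAt_snd)
  have h2 : fderiv ℂ (fun p : ℂ × CVec d => Sc (a * p.1) p.2) p = _ := h1.fderiv
  refine LinearMap.ext fun v => ?_
  simp [h2]

/-- Compositions of holomorphic methods preserve the bilinear forms that the substeps preserve. -/
theorem eventually_listComposition_isometry (J : Matrix (Fin d) (Fin d) ℂ)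
    (hA : AnalyticAt ℂ (fun p : ℂ × CVec d => Sc p.1 p.2) (0, toComplex x₀))
    (h0 : Sc 0 (toComplex x₀) = toComplex x₀)
    (hJ : ∀ᶠ z in 𝓝 ((0 : ℂ), toComplex x₀),
      (complexJacobian (fun p => Sc p.1 p.2) z)ᵀ * J * complexJacobian (fun p => Sc p.1 p.2) z = J)
    (l : List ℂ) :
    ∀ᶠ z in 𝓝 ((0 : ℂ), toComplex x₀),
      (complexJacobian (fun p => listComposition Sc l p.1 p.2) z)ᵀ * J *
        complexJacobian (fun p => listComposition Sc l p.1 p.2) z = J := by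
  induction l with
  | nil =>
    refine Eventually.of_forall fun z => ?_
    have : complexJacobian (fun p : ℂ × CVec d => listComposition Sc [] p.1 p.2) z = 1 := by
      have h1 : fderiv ℂ (fun p : ℂ × CVec d => listComposition Sc [] p.1 p.2) z
        = ContinuousLinearMap.snd ℂ ℂ (CVec d) := fderiv_snd
      rw [complexJacobian, h1, ContinuousLinearMap.snd_comp_inr]
      exact LinearMap.toMatrix'_id
    simp [this]
  | cons a l ih =>
    have hdl := (listComposition_analyticAt hA h0 l).eventually_analyticAt
    filter_upwards [(tendsto_substep hA h0 a).eventually (ih.and hdl),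
      (tendsto_scale a (toComplex x₀)).eventually (hJ.and hA.eventually_analyticAt),
      (analyticAt_substep hA a).eventually_analyticAt] with z h1 h2 h3
    simp only [listComposition_cons]
    rw [complexJacobian_comp (Φ := fun p : ℂ × CVec d => listComposition Sc l p.1 p.2)
      (Θ := fun p => Sc (a * p.1) p.2) h1.2.differentiableAt h3.differentiableAt,
      complexJacobian_substep h2.2.differentiableAt]
    set B := complexJacobian (fun p => Sc p.1 p.2) (a * z.1, z.2)
    set A := complexJacobian (fun p : ℂ × CVec d => listComposition Sc l p.1 p.2)
      (z.1, Sc (a * z.1) z.2)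
    calc (A * B)ᵀ * J * (A * B) = Bᵀ * (Aᵀ * J * A) * B := by
          simp only [Matrix.transpose_mul, Matrix.mul_assoc]
      _ = J := by rw [h1.1, h2.1]

/-- At real points the state derivative of the restriction is given by the complex derivative. -/
theorem stateDeriv_restrict {Φ : ℂ × CVec d → CVec d} {p : ℝ × RVec d}
    (h : DifferentiableAt ℂ Φ (pairToComplexL d p)) (v : RVec d) :
    stateDeriv (fun p => Φ (pairToComplexL d p)) p v
      = fderiv ℂ Φ (pairToComplexL d p) (0, toComplex v) := by
  have h1 : HasFDerivAt (fun p => Φ (pairToComplexL d p))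
      (((fderiv ℂ Φ (pairToComplexL d p)).restrictScalars ℝ).comp (pairToComplexL d)) p :=
    (h.hasFDerivAt.restrictScalars ℝ).comp p (pairToComplexL d).hasFDerivAt
  rw [stateDeriv, h1.fderiv]
  simp

theorem toComplex_single (j : Fin d) : toComplex (Pi.single j 1 : RVec d) = Pi.single j 1 := by
  ext i
  by_cases h : i = j
  · subst h; simp
  · simp [h]

theorem jacobian_apply (M : ℝ → RVec d → RVec d) (h : ℝ) (x : RVec d) (i j : Fin d) :
    jacobian M h x i j = fderiv ℝ (M h) x (Pi.single j 1) i := by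
  simp [jacobian, LinearMap.toMatrix'_apply]

theorem jacobian_eq_stateDeriv {M : ℝ → RVec d → RVec d} {p : ℝ × RVec d}
    (h : DifferentiableAt ℝ (fun p : ℝ × RVec d => M p.1 p.2) p) (i j : Fin d) :
    jacobian M p.1 p.2 i j = stateDeriv (fun p : ℝ × RVec d => M p.1 p.2) p (Pi.single j 1) i := by
  rw [jacobian_apply, ← (hasFDerivAt_stateDeriv h).fderiv]

theorem map_ofReal_mul (A B : Matrix (Fin d) (Fin d) ℝ) :
    (A * B).map Complex.ofReal = A.map Complex.ofReal * B.map Complex.ofReal :=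
  Matrix.map_mul (f := Complex.ofRealHom)

theorem fderiv_continuousLinearMap_comp {E F G : Type*} [NormedAddCommGroup E] [NormedSpace ℝ E]
    [NormedAddCommGroup F] [NormedSpace ℝ F] [NormedAddCommGroup G] [NormedSpace ℝ G]
    (L : F →L[ℝ] G) {g : E → F} {p : E} (h : DifferentiableAt ℝ g p) :
    fderiv ℝ (fun q => L (g q)) p = L.comp (fderiv ℝ g p) :=
  (L.hasFDerivAt.comp p h.hasFDerivAt).fderiv

/-- The holomorphic extension of a symplectic method is symplectic. -/
theorem IsHolomorphicExtension.eventually_symplectic {D : Set (RVec d)}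
    {S : ℝ → RVec d → RVec d} (hext : IsHolomorphicExtension D S Sc) (hx₀ : x₀ ∈ D) {m : ℕ}
    (e : Fin m ⊕ Fin m ≃ Fin d) (hS : IsSymplecticMethod e D S) :
    ∀ᶠ z in 𝓝 ((0 : ℂ), toComplex x₀),
      (complexJacobian (fun p => Sc p.1 p.2) z)ᵀ * (canonicalJ e).map Complex.ofReal *
        complexJacobian (fun p => Sc p.1 p.2) z = (canonicalJ e).map Complex.ofReal := by
  obtain ⟨hA, hSc⟩ := hext x₀ hx₀
  have hent : ∀ i j, AnalyticAt ℂ (fun z => complexJacobian (fun p => Sc p.1 p.2) z i j)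
      (0, toComplex x₀) := by
    intro i j
    simp only [complexJacobian_apply]
    exact ((ContinuousLinearMap.proj (R := ℂ) (φ := fun _ : Fin d => ℂ) i).comp
      (ContinuousLinearMap.apply ℂ (CVec d) ((0 : ℂ), (Pi.single j 1 : CVec d)))).analyticAt _
      |>.comp hA.fderiv
  -- At real points the complex Jacobian is the real one, so the entries of the symplecticity defect
  -- are holomorphic functions vanishing at real points.
  have hreal : ∀ᶠ p in 𝓝 ((0 : ℝ), x₀), complexJacobian (fun p => Sc p.1 p.2) (pairToComplexL d p)
      = (jacobian S p.1 p.2).map Complex.ofReal := by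
    filter_upwards [hSc.eventually_nhds,
      (tendsto_pairToComplexL x₀).eventually hA.eventually_analyticAt] with p h1 h2
    have hg : DifferentiableAt ℝ (fun p : ℝ × RVec d => Sc (pairToComplexL d p).1
        (pairToComplexL d p).2) p :=
      (h2.differentiableAt.restrictScalars ℝ).comp p (pairToComplexL d).differentiableAt
    have h3 : (fun p : ℝ × RVec d => Sc (pairToComplexL d p).1 (pairToComplexL d p).2)
        =ᶠ[𝓝 p] fun p => toComplexL d (S p.1 p.2) := h1
    have hSd : DifferentiableAt ℝ (fun p : ℝ × RVec d => S p.1 p.2) p := by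
      have h4 := (realPartL d).differentiableAt.comp p hg
      refine h4.congr_of_eventuallyEq (h1.mono fun q hq => ?_)
      simp [hq]
    ext i j
    rw [complexJacobian_apply, Matrix.map_apply, jacobian_eq_stateDeriv hSd, ← toComplex_single,
      ← stateDeriv_restrict h2.differentiableAt]
    have h5 : stateDeriv (fun p : ℝ × RVec d => Sc (pairToComplexL d p).1 (pairToComplexL d p).2) p
        = (toComplexL d).comp (stateDeriv (fun p : ℝ × RVec d => S p.1 p.2) p) := by
      rw [stateDeriv, h3.fderiv_eq, fderiv_continuousLinearMap_comp (toComplexL d) hSd]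
      rfl
    rw [h5]
    rfl
  have hij : ∀ i j, ∀ᶠ z in 𝓝 ((0 : ℂ), toComplex x₀),
      ((complexJacobian (fun p => Sc p.1 p.2) z)ᵀ * (canonicalJ e).map Complex.ofReal *
        complexJacobian (fun p => Sc p.1 p.2) z) i j - (canonicalJ e).map Complex.ofReal i j = 0 := by
    intro i j
    refine eventually_eq_zero_of_analyticAt ?_ ?_
    · simp only [Matrix.mul_apply, Matrix.transpose_apply]
      refine AnalyticAt.sub ?_ analyticAt_const
      refine Finset.analyticAt_fun_sum _ fun k _ => AnalyticAt.mul ?_ (hent _ _)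
      exact Finset.analyticAt_fun_sum _ fun k _ => (hent _ _).mul analyticAt_const
    · filter_upwards [hreal, hS.2 x₀ hx₀] with p h1 h2
      rw [h1, ← Matrix.transpose_map, ← map_ofReal_mul, ← map_ofReal_mul, h2, sub_self]
  have hall : ∀ᶠ z in 𝓝 ((0 : ℂ), toComplex x₀), ∀ i j, _ :=
    eventually_all.2 fun i => eventually_all.2 fun j => hij i j
  filter_upwards [hall] with z hz
  ext i j
  exact sub_eq_zero.1 (hz i j)

end Composition

/-! ### The adjoint method from the inverse function theorem. -/

section Adjoint

variable {X : Type*} [NormedAddCommGroup X] [NormedSpace ℝ X] [CompleteSpace X]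

/-- A near-identity family `M` has a local inverse of `M (-h)`, and it agrees with `M h` up to the
defect of `M (-h) ∘ M h` from the identity. -/
theorem exists_adjoint {M : ℝ × X → X} {x₀ : X} (hM : ContDiffAt ℝ ∞ M (0, x₀))
    (hM0 : ∀ᶠ x in 𝓝 x₀, M (0, x) = x) {k : ℕ}
    (hs : (fun p : ℝ × X => M (-p.1, M p) - p.2) =O[𝓝 (0, x₀)] fun p => p.1 ^ k) :
    ∃ N : ℝ × X → X, ContinuousAt N (0, x₀) ∧ N (0, x₀) = x₀ ∧
      (∀ᶠ p in 𝓝 ((0 : ℝ), x₀), M (-p.1, N p) = p.2 ∧ N (p.1, M (-p.1, p.2)) = p.2) ∧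
      (fun p => N p - M p) =O[𝓝 (0, x₀)] fun p => p.1 ^ k := by
  have hM00 : M (0, x₀) = x₀ := hM0.self_of_nhds
  have hMt : Tendsto M (𝓝 (0, x₀)) (𝓝 x₀) := by
    simpa [ContinuousAt, hM00] using hM.continuousAt
  have hd : DifferentiableAt ℝ M (0, x₀) := hM.differentiableAt (by simp)
  have hstate : stateDeriv M (0, x₀) = ContinuousLinearMap.id ℝ X :=
    (hasFDerivAt_stateDeriv hd).unique
      ((hasFDerivAt_id x₀).congr_of_eventuallyEq hM0)
  set c := stepDeriv M (0, x₀) with hc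
  have hfd : ∀ t v, fderiv ℝ M (0, x₀) (t, v) = t • c + v := by
    intro t v
    have h1 : ((t, v) : ℝ × X) = t • ((1 : ℝ), (0 : X)) + (0, v) := by simp
    have h2 : fderiv ℝ M (0, x₀) (0, v) = v := by
      simpa [stateDeriv] using DFunLike.congr_fun hstate v
    rw [h1, map_add, map_smul, h2, hc, stepDeriv]
  let Ξ : ℝ × X → ℝ × X := fun p => (p.1, M (-p.1, p.2))
  -- As `M 0` is the identity near `x₀`, the derivative of `Ξ` is the shear `(t, v) ↦ (t, v - t c)`,
  -- inverted by `(t, v) ↦ (t, v + t c)`. Keeping the step size as a coordinate inverts all `M (-h)`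
  -- at once.
  let A : (ℝ × X) ≃L[ℝ] (ℝ × X) := ContinuousLinearEquiv.equivOfInverse
    ((ContinuousLinearMap.fst ℝ ℝ X).prod
      (ContinuousLinearMap.snd ℝ ℝ X - (ContinuousLinearMap.fst ℝ ℝ X).smulRight c))
    ((ContinuousLinearMap.fst ℝ ℝ X).prod
      (ContinuousLinearMap.snd ℝ ℝ X + (ContinuousLinearMap.fst ℝ ℝ X).smulRight c))
    (fun p => by simp) (fun p => by simp)
  have hneg : HasStrictFDerivAt (fun p : ℝ × X => (-p.1, p.2))
      ((-ContinuousLinearMap.fst ℝ ℝ X).prod (ContinuousLinearMap.snd ℝ ℝ X)) (0, x₀) :=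
    hasStrictFDerivAt_fst.neg.prodMk hasStrictFDerivAt_snd
  have hMs : HasStrictFDerivAt M (fderiv ℝ M (0, x₀)) (-(0, x₀).1, ((0 : ℝ), x₀).2) := by
    simpa using hM.hasStrictFDerivAt (by simp)
  have hΞ : HasStrictFDerivAt Ξ (A : ℝ × X →L[ℝ] ℝ × X) (0, x₀) := by
    have h1 := hasStrictFDerivAt_fst.prodMk
      (HasStrictFDerivAt.comp (g := M) (f := fun p : ℝ × X => (-p.1, p.2)) (0, x₀) hMs hneg)
    refine h1.congr_fderiv (ContinuousLinearMap.ext fun p => ?_)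
    have h2 := hfd (-p.1) p.2
    simp only [ContinuousLinearMap.prod_apply, ContinuousLinearMap.comp_apply,
      neg_apply, ContinuousLinearMap.coe_fst', ContinuousLinearMap.coe_snd']
    rw [h2]
    refine Prod.ext rfl ?_
    change -p.1 • c + p.2 = p.2 - p.1 • c
    rw [neg_smul, neg_add_eq_sub]
  have hΞ0 : Ξ (0, x₀) = (0, x₀) := by simp [Ξ, hM00]
  set loc := hΞ.localInverse Ξ A (0, x₀) with hloc
  have hl0 : loc (0, x₀) = (0, x₀) := by
    have := hΞ.localInverse_apply_image
    rwa [hΞ0] at this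
  have hls : HasStrictFDerivAt loc (A.symm : ℝ × X →L[ℝ] ℝ × X) (0, x₀) := by
    have := hΞ.to_localInverse
    rwa [hΞ0] at this
  have hright : ∀ᶠ p in 𝓝 ((0 : ℝ), x₀), Ξ (loc p) = p := by
    have := hΞ.eventually_right_inverse
    rwa [hΞ0] at this
  have hleft : ∀ᶠ p in 𝓝 ((0 : ℝ), x₀), loc (Ξ p) = p := hΞ.eventually_left_inverse
  refine ⟨fun p => (loc p).2, ?_, by simp [hl0], ?_, ?_⟩
  · exact hls.continuousAt.snd
  · filter_upwards [hright, hleft] with p h1 h2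
    constructor
    · have h3 : (Ξ (loc p)).1 = p.1 := by rw [h1]
      have h4 : (Ξ (loc p)).2 = p.2 := by rw [h1]
      have h5 : (loc p).1 = p.1 := h3
      rwa [← h5]
    · exact congrArg Prod.snd h2
  · have ht : Tendsto (fun p : ℝ × X => (p.1, M p)) (𝓝 (0, x₀)) (𝓝 (0, x₀)) :=
      (continuous_fst.tendsto _).prodMk_nhds hMt
    have htt : Tendsto (fun p : ℝ × X => Ξ (p.1, M p)) (𝓝 (0, x₀)) (𝓝 (0, x₀)) := by
      have h1 : Tendsto Ξ (𝓝 (0, x₀)) (𝓝 (0, x₀)) := by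
        simpa [ContinuousAt, hΞ0] using hΞ.continuousAt
      exact h1.comp ht
    -- The local inverse is Lipschitz. It sends `p` to `(h, N p)` and `Ξ (h, M p)` to `(h, M p)`, so
    -- `N - M` is bounded by `p - Ξ (h, M p)`, the defect of `M (-h) ∘ M h`.
    have h1 := hls.isBigO_sub.comp_tendsto (k := fun p : ℝ × X => (p, Ξ (p.1, M p)))
      (by rw [nhds_prod_eq]; exact tendsto_id.prodMk htt)
    have h2 : (fun p : ℝ × X => p - Ξ (p.1, M p)) =O[𝓝 (0, x₀)] fun p => p.1 ^ k := by
      refine IsBigO.trans (IsBigO.of_norm_le fun p => ?_) hs.norm_left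
      simp [Ξ, Prod.norm_def, norm_sub_rev]
    have h3 := h1.trans h2
    refine IsBigO.trans (IsBigO.of_bound 1 ?_) h3
    filter_upwards [ht.eventually hleft] with p hp
    simp only [Function.comp_apply, hp, one_mul]
    exact norm_snd_le ((loc p - (p.1, M p)))

end Adjoint

/-! ### Real and imaginary parts of a map inverted by its conjugate with opposite step size. -/

section RealPart

variable {d : ℕ} {Φ : ℂ × CVec d → CVec d} {x₀ : RVec d}

/-- The restriction of a holomorphic function to real points. -/
noncomputable def realRestrict (Φ : ℂ × CVec d → CVec d) (p : ℝ × RVec d) : CVec d :=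
  Φ (pairToComplexL d p)

/-- The real part of a holomorphic function at real points. -/
noncomputable def realPartMap (Φ : ℂ × CVec d → CVec d) (p : ℝ × RVec d) : RVec d :=
  realPartL d (realRestrict Φ p)

/-- The imaginary part of a holomorphic function at real points. -/
noncomputable def imagPartMap (Φ : ℂ × CVec d → CVec d) (p : ℝ × RVec d) : RVec d :=
  imagPartL d (realRestrict Φ p)

theorem realRestrict_analyticAt (hA : AnalyticAt ℂ Φ (0, toComplex x₀)) :
    AnalyticAt ℝ (realRestrict Φ) (0, x₀) := by
  refine AnalyticAt.fun_comp (g := Φ) (f := pairToComplexL d) ?_ ((pairToComplexL d).analyticAt _)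
  rw [pairToComplexL_zero]
  exact hA.restrictScalars

theorem realPartMap_analyticAt (hA : AnalyticAt ℂ Φ (0, toComplex x₀)) :
    AnalyticAt ℝ (realPartMap Φ) (0, x₀) :=
  ((realPartL d).analyticAt _).fun_comp (realRestrict_analyticAt hA)

theorem imagPartMap_analyticAt (hA : AnalyticAt ℂ Φ (0, toComplex x₀)) :
    AnalyticAt ℝ (imagPartMap Φ) (0, x₀) :=
  ((imagPartL d).analyticAt _).fun_comp (realRestrict_analyticAt hA)

theorem realPartMap_of_eq {h : ℝ} {x : RVec d} (hx : Φ (h, toComplex x) = toComplex x) :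
    realPartMap Φ (h, x) = x := by
  rw [realPartMap, realRestrict, pairToComplexL_apply, hx, realPartL_toComplex]

theorem stateDeriv_realPartMap {p : ℝ × RVec d} (h : DifferentiableAt ℂ Φ (pairToComplexL d p))
    (v : RVec d) :
    stateDeriv (realPartMap Φ) p v
      = realPartL d (fderiv ℂ Φ (pairToComplexL d p) (0, toComplex v)) := by
  have hg : DifferentiableAt ℝ (realRestrict Φ) p :=
    (h.restrictScalars ℝ).comp p (pairToComplexL d).differentiableAt
  have h1 : fderiv ℝ (realPartMap Φ) p = _ := fderiv_continuousLinearMap_comp (realPartL d) hg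
  rw [← stateDeriv_restrict h, stateDeriv, h1]
  rfl

theorem stateDeriv_imagPartMap {p : ℝ × RVec d} (h : DifferentiableAt ℂ Φ (pairToComplexL d p))
    (v : RVec d) :
    stateDeriv (imagPartMap Φ) p v
      = imagPartL d (fderiv ℂ Φ (pairToComplexL d p) (0, toComplex v)) := by
  have hg : DifferentiableAt ℝ (realRestrict Φ) p :=
    (h.restrictScalars ℝ).comp p (pairToComplexL d).differentiableAt
  have h1 : fderiv ℝ (imagPartMap Φ) p = _ := fderiv_continuousLinearMap_comp (imagPartL d) hg
  rw [← stateDeriv_restrict h, stateDeriv, h1]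
  rfl

/-- Expansion of `Φ (-h) (conj (Φ h x)) = x` in the imaginary part of `Φ h x`. -/
theorem conjugate_expansion (hA : AnalyticAt ℂ Φ (0, toComplex x₀))
    (h0 : Φ (0, toComplex x₀) = toComplex x₀)
    (hinv : ∀ᶠ p : ℝ × RVec d in 𝓝 (0, x₀),
      Φ (-(p.1 : ℂ), star (realRestrict Φ p)) = toComplex p.2)
    {k : ℕ} (hk : k ≠ 0) (hv : imagPartMap Φ =O[𝓝 (0, x₀)] fun p => p.1 ^ k) :
    (fun p : ℝ × RVec d => toComplex p.2 - realRestrict Φ (-p.1, realPartMap Φ p)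
      + Complex.I • fderiv ℂ Φ (pairToComplexL d (-p.1, realPartMap Φ p))
          (0, toComplex (imagPartMap Φ p)))
      =O[𝓝 (0, x₀)] fun p => p.1 ^ (2 * k) := by
  let F : ℝ × CVec d → CVec d := fun q => Φ ((q.1 : ℂ), q.2)
  let ι : ℝ × CVec d →L[ℝ] ℂ × CVec d :=
    Complex.ofRealCLM.prodMap (ContinuousLinearMap.id ℝ (CVec d))
  have hF : ContDiffAt ℝ ∞ F (0, toComplex x₀) := by
    refine AnalyticAt.contDiffAt ?_
    refine AnalyticAt.fun_comp (g := Φ) (f := ι) ?_ (ι.analyticAt _)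
    simpa [ι] using hA.restrictScalars
  have hg : Tendsto (realRestrict Φ) (𝓝 (0, x₀)) (𝓝 (toComplex x₀)) :=
    (tendsto_of_analyticAt hA h0).comp (tendsto_pairToComplexL x₀)
  have hut : Tendsto (realPartMap Φ) (𝓝 (0, x₀)) (𝓝 x₀) := by
    have := ((realPartL d).continuous.tendsto _).comp hg
    rwa [realPartL_toComplex] at this
  have ha : Tendsto (fun p => toComplex (realPartMap Φ p)) (𝓝 (0, x₀)) (𝓝 (toComplex x₀)) :=
    ((toComplexL d).continuous.tendsto x₀).comp hut
  have hneg : Tendsto (fun p : ℝ × RVec d => -p.1) (𝓝 (0, x₀)) (𝓝 0) :=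
    Continuous.tendsto' (by fun_prop) _ _ (by simp)
  have he : (fun p => -(Complex.I • toComplex (imagPartMap Φ p))) =O[𝓝 (0, x₀)]
      fun p : ℝ × RVec d => p.1 ^ k := by
    refine (IsBigO.trans ?_ hv).neg_left
    exact (((toComplexL d).isBigO_comp _ _).const_smul_left Complex.I)
  -- The expansion point is the real state `u_h` and the increment is `-i v_h`; the remainder is
  -- quadratic in `v_h`.
  have key := (taylor_isBigO hF hneg ha (tendsto_zero_of_isBigO_pow hk he)).trans
    (norm_sq_isBigO_pow he)
  refine key.congr' ?_ EventuallyEq.rfl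
  filter_upwards [hinv, ((tendsto_pairToComplexL x₀).comp
    (tendsto_neg_step hut)).eventually hA.eventually_analyticAt] with p h1 h2
  have h3 : F (-p.1, toComplex (realPartMap Φ p) + -(Complex.I • toComplex (imagPartMap Φ p)))
      = toComplex p.2 := by
    rw [← h1, star_eq_realPartL_sub, sub_eq_add_neg]
    simp [F, realPartMap, imagPartMap]
  have hdd : DifferentiableAt ℂ Φ (ι (-p.1, toComplex (realPartMap Φ p))) :=
    h2.differentiableAt
  have h4 : HasFDerivAt F (((fderiv ℂ Φ (ι (-p.1, toComplex (realPartMap Φ p)))).restrictScalars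
      ℝ).comp ι) (-p.1, toComplex (realPartMap Φ p)) :=
    (hdd.hasFDerivAt.restrictScalars ℝ).comp _ ι.hasFDerivAt
  have h5 : ∀ w, stateDeriv F (-p.1, toComplex (realPartMap Φ p)) w
      = fderiv ℂ Φ (pairToComplexL d (-p.1, realPartMap Φ p)) (0, w) := by
    intro w
    rw [stateDeriv, h4.fderiv]
    simp [ι]
  have h6 : ((0 : ℂ), -(Complex.I • toComplex (imagPartMap Φ p)))
      = -(Complex.I • ((0 : ℂ), toComplex (imagPartMap Φ p))) := by simp
  rw [h3, h5, h6, map_neg, map_smul, sub_neg_eq_add]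
  rfl

/-- If `Φ` is inverted by its conjugate with opposite step size, then its real part is time-symmetric
up to the square of its imaginary part. -/
theorem realPartMap_symm_isBigO (hA : AnalyticAt ℂ Φ (0, toComplex x₀))
    (h0 : Φ (0, toComplex x₀) = toComplex x₀)
    (hinv : ∀ᶠ p : ℝ × RVec d in 𝓝 (0, x₀),
      Φ (-(p.1 : ℂ), star (realRestrict Φ p)) = toComplex p.2)
    {k : ℕ} (hk : k ≠ 0) (hv : imagPartMap Φ =O[𝓝 (0, x₀)] fun p => p.1 ^ k) :
    (fun p => realPartMap Φ (-p.1, realPartMap Φ p) - p.2)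
      =O[𝓝 (0, x₀)] fun p => p.1 ^ (2 * k) := by
  have hut : Tendsto (realPartMap Φ) (𝓝 (0, x₀)) (𝓝 x₀) := by
    have := ((realPartL d).continuous.tendsto _).comp
      ((tendsto_of_analyticAt hA h0).comp (tendsto_pairToComplexL x₀))
    rwa [realPartL_toComplex] at this
  have h1 := ((realPartL d).isBigO_comp _ _).trans (conjugate_expansion hA h0 hinv hk hv)
  -- The real part of `i ψ'_{-h}(u_h) v_h` is `-v'_{-h}(u_h) v_h`, a product of two factors of order
  -- `k`.
  have h2 := isBigO_comp_neg_step (stateDeriv_isBigO k (imagPartMap_analyticAt hA).contDiffAt hv) hut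
  have h3 : (fun p => stateDeriv (imagPartMap Φ) (-p.1, realPartMap Φ p) (imagPartMap Φ p))
      =O[𝓝 (0, x₀)] fun p => p.1 ^ (2 * k) := by
    have h4 : (fun p => stateDeriv (imagPartMap Φ) (-p.1, realPartMap Φ p) (imagPartMap Φ p))
        =O[𝓝 (0, x₀)] fun p =>
          ‖stateDeriv (imagPartMap Φ) (-p.1, realPartMap Φ p)‖ * ‖imagPartMap Φ p‖ :=
      IsBigO.of_bound 1 (Eventually.of_forall fun p => by
        simpa using (stateDeriv (imagPartMap Φ) (-p.1, realPartMap Φ p)).le_opNorm _)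
    refine (h4.trans (h2.norm_left.mul hv.norm_left)).congr_right fun p => ?_
    ring
  refine (h1.add h3).neg_left.congr' ?_ EventuallyEq.rfl
  filter_upwards [((tendsto_pairToComplexL x₀).comp
    (tendsto_neg_step hut)).eventually hA.eventually_analyticAt] with p hp
  rw [stateDeriv_imagPartMap hp.differentiableAt]
  ext i
  simp [realPartMap]

/-- If `Φ` is inverted by its conjugate with opposite step size, then its imaginary part is of even
order. -/
theorem imagPartMap_isBigO_succ (hA : AnalyticAt ℂ Φ (0, toComplex x₀))
    (h0 : ∀ᶠ x in 𝓝 x₀, Φ (0, toComplex x) = toComplex x)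
    (hinv : ∀ᶠ p : ℝ × RVec d in 𝓝 (0, x₀),
      Φ (-(p.1 : ℂ), star (realRestrict Φ p)) = toComplex p.2)
    {k : ℕ} (hk : Odd k) (hv : imagPartMap Φ =O[𝓝 (0, x₀)] fun p => p.1 ^ k) :
    imagPartMap Φ =O[𝓝 (0, x₀)] fun p => p.1 ^ (k + 1) := by
  have hk1 : 1 ≤ k := hk.pos
  have hu0 : ∀ᶠ x in 𝓝 x₀, realPartMap Φ (0, x) = x :=
    h0.mono fun x hx => realPartMap_of_eq (by simpa using hx)
  have hu := (realPartMap_analyticAt hA).contDiffAt (n := ∞)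
  have hut : Tendsto (realPartMap Φ) (𝓝 (0, x₀)) (𝓝 x₀) := by
    simpa [ContinuousAt, hu0.self_of_nhds] using hu.continuousAt
  refine isBigO_succ_of_parity (imagPartMap_analyticAt hA).contDiffAt hv hu hu0 ?_
  have h1 := ((imagPartL d).isBigO_comp _ _).trans
    (conjugate_expansion hA h0.self_of_nhds hinv (by omega) hv)
  have h2 := displacement_isBigO hu hu0 hut hv
  -- The imaginary part of the expansion is `u'_{-h}(u_h) v_h - v_{-h}(u_h)`. Replacing
  -- `u'_{-h}(u_h) v_h` by `v_h` costs one order above `k`, and `k + 1 ≤ 2 * k`.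
  refine ((isBigO_pow_mono (by omega) h1).sub h2).congr' ?_ EventuallyEq.rfl
  filter_upwards [((tendsto_pairToComplexL x₀).comp
    (tendsto_neg_step hut)).eventually hA.eventually_analyticAt] with p hp
  rw [stateDeriv_realPartMap hp.differentiableAt]
  ext i
  simp [imagPartMap, hk.neg_one_pow]
  ring

/-- If `Φ` is symplectic, then its real part is symplectic up to the square of its imaginary part. -/
theorem realPartMap_symplectic_isBigO (J : Matrix (Fin d) (Fin d) ℝ) {M : ℝ → RVec d → RVec d}
    (hM : ∀ p : ℝ × RVec d, M p.1 p.2 = realPartMap Φ p) (hA : AnalyticAt ℂ Φ (0, toComplex x₀))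
    (hJ : ∀ᶠ z in 𝓝 ((0 : ℂ), toComplex x₀),
      (complexJacobian Φ z)ᵀ * J.map Complex.ofReal * complexJacobian Φ z = J.map Complex.ofReal)
    {k : ℕ} (hv : imagPartMap Φ =O[𝓝 (0, x₀)] fun p => p.1 ^ k) (i j : Fin d) :
    (fun p : ℝ × RVec d => ((jacobian M p.1 p.2)ᵀ * J * jacobian M p.1 p.2 - J) i j)
      =O[𝓝 (0, x₀)] fun p => p.1 ^ (2 * k) := by
  let V : ℝ × RVec d → Matrix (Fin d) (Fin d) ℝ := fun p =>
    Matrix.of fun i j => stateDeriv (imagPartMap Φ) p (Pi.single j 1) i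
  have hM' : (fun p : ℝ × RVec d => M p.1 p.2) = realPartMap Φ := funext hM
  have hV : ∀ i j, (fun p => V p i j) =O[𝓝 (0, x₀)] fun p => p.1 ^ k := by
    intro i j
    refine IsBigO.trans ?_ (stateDeriv_isBigO k (imagPartMap_analyticAt hA).contDiffAt hv)
    have := ((ContinuousLinearMap.proj (R := ℝ) (φ := fun _ : Fin d => ℝ) i).comp
      (ContinuousLinearMap.apply ℝ (RVec d) (Pi.single j 1 : RVec d))).isBigO_comp
      (stateDeriv (imagPartMap Φ)) (𝓝 (0, x₀))
    exact this
  have hVV : (fun p => ((V p)ᵀ * J * V p) i j) =O[𝓝 (0, x₀)] fun p => p.1 ^ (2 * k) := by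
    simp only [Matrix.mul_apply, Matrix.transpose_apply, Finset.sum_mul]
    refine IsBigO.fun_sum fun a _ => IsBigO.fun_sum fun b _ => ?_
    refine (((hV b i).mul (hV a j)).const_mul_left (J b a)).congr (fun p => ?_) fun p => ?_ <;> ring
  refine hVV.congr' ?_ EventuallyEq.rfl
  have hr := tendsto_pairToComplexL x₀
  filter_upwards [hr.eventually hJ, hr.eventually hA.eventually_analyticAt,
    (realPartMap_analyticAt hA).eventually_analyticAt] with p h1 h2 h3
  have hC : complexJacobian Φ (pairToComplexL d p)
      = (jacobian M p.1 p.2).map Complex.ofReal + Complex.I • (V p).map Complex.ofReal := by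
    ext a b
    have h4 := toComplex_realPartL_add (fderiv ℂ Φ (pairToComplexL d p) (0, Pi.single b 1))
    rw [← toComplex_single, ← stateDeriv_realPartMap h2.differentiableAt,
      ← stateDeriv_imagPartMap h2.differentiableAt, toComplex_single] at h4
    rw [complexJacobian_apply, ← h4]
    simp only [Matrix.add_apply, Matrix.map_apply, Matrix.smul_apply]
    rw [jacobian_eq_stateDeriv (by rw [hM']; exact h3.differentiableAt), hM']
    rfl
  set U := jacobian M p.1 p.2
  have h5 : (complexJacobian Φ (pairToComplexL d p))ᵀ * J.map Complex.ofReal *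
      complexJacobian Φ (pairToComplexL d p)
      = (Uᵀ * J * U).map Complex.ofReal - ((V p)ᵀ * J * V p).map Complex.ofReal
        + Complex.I • ((Uᵀ * J * V p).map Complex.ofReal + ((V p)ᵀ * J * U).map Complex.ofReal) := by
    rw [hC]
    simp only [map_ofReal_mul, Matrix.transpose_map, Matrix.transpose_add, Matrix.transpose_smul,
      Matrix.add_mul, Matrix.mul_add, Matrix.smul_mul, Matrix.mul_smul, smul_smul, smul_add,
      Complex.I_mul_I, neg_smul, one_smul]
    abel
  -- The mixed terms `UᵀJV + VᵀJU` are purely imaginary and drop out of the real part, so no term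
  -- linear in `V` survives.
  have h6 := congrArg (fun A : Matrix (Fin d) (Fin d) ℂ => (A i j).re) (h5.symm.trans h1)
  simp only [Matrix.add_apply, Matrix.sub_apply, Matrix.smul_apply, Matrix.map_apply,
    smul_eq_mul, Complex.add_re, Complex.sub_re, Complex.ofReal_re, Complex.mul_re, Complex.I_re,
    Complex.I_im, Complex.add_im, Complex.ofReal_im] at h6
  rw [Matrix.sub_apply]
  linarith

end RealPart

/-! ### Real parts of symmetric-conjugate compositions. -/

section Main

variable {d s : ℕ} {D : Set (RVec d)} {f : RVec d → RVec d} {S : ℝ → RVec d → RVec d}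
  {Sc : ℂ → CVec d → CVec d} {α : Fin s → ℂ}

/-- The composition as a function of the pair of step size and state. -/
def compositionMap (Sc : ℂ → CVec d → CVec d) (α : Fin s → ℂ) (z : ℂ × CVec d) : CVec d :=
  listComposition Sc (List.ofFn α) z.1 z.2

theorem realPartMethod_eq (h : ℝ) (x : RVec d) :
    realPartMethod Sc α h x = realPartMap (compositionMap Sc α) (h, x) := rfl

/-- The local properties of a symmetric-conjugate composition near a real point: it is holomorphic,
the identity for step size `0`, and inverted by its conjugate with opposite step size. -/
theorem compositionMap_properties (hsymm : IsTimeSymmetric D S) (horder : HasOrder f D S 2)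
    (hext : IsHolomorphicExtension D S Sc) (hα : IsSymmetricConjugate α) {x₀ : RVec d}
    (hx₀ : x₀ ∈ D) :
    AnalyticAt ℂ (compositionMap Sc α) (0, toComplex x₀) ∧
      (∀ᶠ x in 𝓝 x₀, compositionMap Sc α (0, toComplex x) = toComplex x) ∧
      ∀ᶠ p : ℝ × RVec d in 𝓝 (0, x₀),
        compositionMap Sc α (-(p.1 : ℂ), star (realRestrict (compositionMap Sc α) p))
          = toComplex p.2 := by
  have hA := (hext x₀ hx₀).1
  have hS0 := eventually_zero_of_hasOrder horder hx₀
  have h0 := hext.eventually_zero hx₀ hS0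
  have hc : Tendsto (toComplex (d := d)) (𝓝 x₀) (𝓝 (toComplex x₀)) :=
    (toComplexL d).continuous.tendsto x₀
  refine ⟨listComposition_analyticAt hA h0.self_of_nhds _, ?_, ?_⟩
  · exact (hc.eventually h0).mono fun x hx => listComposition_zero hx _
  · exact eventually_listComposition_neg_star hα.reverse_ofFn hA h0.self_of_nhds
      (hext.eventually_symm hx₀ hS0 hsymm) (hext.eventually_star hx₀)

/-- The flow is real, so the imaginary part of the method is the imaginary part of its error. -/
theorem imagPartMap_isBigO_of_hasComplexOrder {r : ℕ}
    (h : HasComplexOrder f D (realStart Sc α) r) {x₀ : RVec d} (hx₀ : x₀ ∈ D) :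
    imagPartMap (compositionMap Sc α) =O[𝓝 (0, x₀)] fun p => p.1 ^ (r + 1) := by
  obtain ⟨φ, -, hO⟩ := h x₀ hx₀
  refine (((imagPartL d).isBigO_comp _ _).trans hO).congr_left fun p => ?_
  rw [map_sub, imagPartL_toComplex, sub_zero]
  rfl

/-- The real part of a composition has the order of the composition. -/
theorem HasComplexOrder.hasOrder_realPartMethod {r : ℕ}
    (h : HasComplexOrder f D (realStart Sc α) r) : HasOrder f D (realPartMethod Sc α) r := by
  intro x₀ hx₀
  obtain ⟨φ, hφ, hO⟩ := h x₀ hx₀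
  refine ⟨φ, hφ, (((realPartL d).isBigO_comp _ _).trans hO).congr_left fun p => ?_⟩
  rw [map_sub, realPartL_toComplex]
  rfl

theorem isSmoothMethod_realPartMethod
    (hA : ∀ x₀ ∈ D, AnalyticAt ℂ (compositionMap Sc α) (0, toComplex x₀)) :
    IsSmoothMethod D (realPartMethod Sc α) := fun x₀ hx₀ =>
  ⟨{p | AnalyticAt ℝ (realPartMap (compositionMap Sc α)) p},
    (realPartMap_analyticAt (hA x₀ hx₀)).eventually_analyticAt,
    fun _ hp => hp.contDiffAt.contDiffWithinAt⟩

/-- If the imaginary part of the composition is `O(h ^ k)`, then its real part is pseudo-symmetric of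
order `2 * k - 1`. -/
theorem isPseudoSymmetric_realPartMethod (hsymm : IsTimeSymmetric D S) (horder : HasOrder f D S 2)
    (hext : IsHolomorphicExtension D S Sc) (hα : IsSymmetricConjugate α) {k q : ℕ}
    (hkq : 2 * k = q + 1)
    (hv : ∀ x₀ ∈ D, imagPartMap (compositionMap Sc α) =O[𝓝 (0, x₀)] fun p => p.1 ^ k) :
    IsPseudoSymmetric D (realPartMethod Sc α) q := by
  refine ⟨isSmoothMethod_realPartMethod fun x₀ hx₀ =>
    (compositionMap_properties hsymm horder hext hα hx₀).1, fun x₀ hx₀ => ?_⟩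
  obtain ⟨hA, h0, hinv⟩ := compositionMap_properties hsymm horder hext hα hx₀
  have hs := realPartMap_symm_isBigO hA h0.self_of_nhds hinv (k := k) (by omega) (hv x₀ hx₀)
  obtain ⟨N, hN, hN0, hNinv, hNO⟩ := exists_adjoint (realPartMap_analyticAt hA).contDiffAt
    (h0.mono fun x hx => realPartMap_of_eq (by simpa using hx)) hs
  rw [hkq] at hNO
  exact ⟨fun h x => N (h, x), ⟨hN, hN0, hNinv⟩, hNO⟩

/-- If the imaginary part of a composition of symplectic methods is `O(h ^ k)`, then its real part
is pseudo-symplectic of order `2 * k - 1`. -/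
theorem isPseudoSymplectic_realPartMethod (hsymm : IsTimeSymmetric D S) (horder : HasOrder f D S 2)
    (hext : IsHolomorphicExtension D S Sc) (hα : IsSymmetricConjugate α) {k q : ℕ}
    (hkq : 2 * k = q + 1)
    (hv : ∀ x₀ ∈ D, imagPartMap (compositionMap Sc α) =O[𝓝 (0, x₀)] fun p => p.1 ^ k)
    {m : ℕ} (e : Fin m ⊕ Fin m ≃ Fin d) (hS : IsSymplecticMethod e D S) :
    IsPseudoSymplectic e D (realPartMethod Sc α) q := by
  refine ⟨isSmoothMethod_realPartMethod fun x₀ hx₀ =>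
    (compositionMap_properties hsymm horder hext hα hx₀).1, fun x₀ hx₀ i j => ?_⟩
  have hSc := (hext x₀ hx₀).1
  have hSc0 := (hext.eventually_zero hx₀ (eventually_zero_of_hasOrder horder hx₀)).self_of_nhds
  rw [← hkq]
  exact realPartMap_symplectic_isBigO (canonicalJ e) (fun p => realPartMethod_eq p.1 p.2)
    (listComposition_analyticAt hSc hSc0 _)
    (eventually_listComposition_isometry _ hSc hSc0 (hext.eventually_symplectic hx₀ e hS) _)
    (hv x₀ hx₀) i j

end Main

theorem proposition2 {d s : ℕ} (D : Set (RVec d)) (hD : IsOpen D)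
    (f : RVec d → RVec d) (hf : ContDiffOn ℝ ∞ f D)
    (S : ℝ → RVec d → RVec d) (hsymm : IsTimeSymmetric D S) (horder : HasOrder f D S 2)
    (Sc : ℂ → CVec d → CVec d) (hext : IsHolomorphicExtension D S Sc)
    (α : Fin s → ℂ) (hα : IsSymmetricConjugate α) (n : ℕ) (hn : 2 ≤ n) :
    (HasComplexOrder f D (realStart Sc α) (2 * n - 1) →
      HasOrder f D (realPartMethod Sc α) (2 * n) ∧
      IsPseudoSymmetric D (realPartMethod Sc α) (4 * n - 1) ∧
      ∀ (m : ℕ) (e : Fin m ⊕ Fin m ≃ Fin d), IsHamiltonian e D f → IsSymplecticMethod e D S →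
        IsPseudoSymplectic e D (realPartMethod Sc α) (4 * n - 1)) ∧
    (HasComplexOrder f D (realStart Sc α) (2 * n) →
      HasOrder f D (realPartMethod Sc α) (2 * n) ∧
      IsPseudoSymmetric D (realPartMethod Sc α) (4 * n + 3) ∧
      ∀ (m : ℕ) (e : Fin m ⊕ Fin m ≃ Fin d), IsHamiltonian e D f → IsSymplecticMethod e D S →
        IsPseudoSymplectic e D (realPartMethod Sc α) (4 * n + 3)) := by
  constructor
  · intro h
    have hr : 2 * n - 1 + 1 = 2 * n := by omega
    have hv : ∀ x₀ ∈ D,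
        imagPartMap (compositionMap Sc α) =O[𝓝 (0, x₀)] fun p => p.1 ^ (2 * n) := fun x₀ hx₀ => by
      simpa only [hr] using imagPartMap_isBigO_of_hasComplexOrder h hx₀
    have hkq : 2 * (2 * n) = 4 * n - 1 + 1 := by omega
    refine ⟨fun x₀ hx₀ => ?_, isPseudoSymmetric_realPartMethod hsymm horder hext hα hkq hv,
      fun m e _ hS => isPseudoSymplectic_realPartMethod hsymm horder hext hα hkq hv e hS⟩
    obtain ⟨hA, h0, hinv⟩ := compositionMap_properties hsymm horder hext hα hx₀
    obtain ⟨φ, hφ, hO⟩ := h.hasOrder_realPartMethod x₀ hx₀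
    rw [hr] at hO
    have hs := realPartMap_symm_isBigO hA h0.self_of_nhds hinv (by omega) (hv x₀ hx₀)
    -- The error starts at the even exponent `2 * n`, where symmetry forbids a leading term;
    -- symmetry up to order `2 * n + 1` suffices, and order `4 * n` is available.
    exact ⟨φ, hφ, isBigO_sub_flow_succ (u := realPartMap (compositionMap Sc α)) hφ
      (hf.contDiffAt (hD.mem_nhds hx₀))
      (realPartMap_analyticAt hA).contDiffAt
      (h0.mono fun x hx => realPartMap_of_eq (by simpa using hx)) (even_two_mul n) (by omega) hO
      (isBigO_pow_mono (by omega) hs)⟩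
  · intro h
    have hv : ∀ x₀ ∈ D, imagPartMap (compositionMap Sc α)
        =O[𝓝 (0, x₀)] fun p => p.1 ^ (2 * n + 1 + 1) := fun x₀ hx₀ => by
      obtain ⟨hA, h0, hinv⟩ := compositionMap_properties hsymm horder hext hα hx₀
      -- The imaginary part starts at the odd exponent `2 * n + 1` and gains one order. Doubling the
      -- exponent turns this into two orders of the symmetry defect, hence `4 * n + 3` instead of `4
      -- * n + 1`.
      exact imagPartMap_isBigO_succ hA h0 hinv (odd_two_mul_add_one n)
        (imagPartMap_isBigO_of_hasComplexOrder h hx₀)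
    have hkq : 2 * (2 * n + 1 + 1) = 4 * n + 3 + 1 := by omega
    exact ⟨h.hasOrder_realPartMethod,
      isPseudoSymmetric_realPartMethod hsymm horder hext hα hkq hv,
      fun m e _ hS => isPseudoSymplectic_realPartMethod hsymm horder hext hα hkq hv e hS⟩
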